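/- Let $\Gamma$ be a triangulation of a connected closed surface $M$ (not necessarily orientable): a finite connected simple graph embedded in $M$ such that all faces are triangles, every edge lies on precisely two distinct faces, and two distinct faces intersect in an edge, in a vertex or not at all. A zigzag of $\Gamma$ is a sequence of edges $(e_i)$ such that, for every $i$, $e_i$ and $e_{i+1}$ are distinct edges of a common face, the faces containing $e_i,e_{i+1}$ and $e_{i+1},e_{i+2}$ are distinct, and $e_i$, $e_{i+2}$ are disjoint; zigzags are periodic and are regarded as cyclic sequences. A $z$-orientation $\tau$ of $\Gamma$ is a set of zigzags that contains precisely one zigzag from each pair of mutually reversed zigzags $Z, Z^{-1}$. The zigzags of $\tau$ pass through every edge precisely twice in total; the edge is of type I if these two passages have different directions, and of type II if they have the same direction, in which case the edge is directed accordingly. A face is of type I if it has two edges of type I and one edge of type II. Let $\Gamma_{II}$ be the subgraph of $\Gamma$ formed by all edges of type II, with their directions, and their vertices. A zigzag is homogeneous if it is a cyclic sequence $\{e_i,e_i',e_i''\}_{i=1}^n$ in which each $e_i$ is of type II and all $e_i',e_i''$ are of type I. Suppose that all faces of $(\Gamma,\tau)$ are of type I. Then the following three conditions are equivalent: (1) all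 zigzags of $\Gamma$ are homogeneous; (2) $\Gamma_{II}$ is a closed 2-cell embedding in $M$ of a simple Eulerian digraph (a simple connected digraph in which every vertex has equally many entering and leaving edges), that is, for every connected component of $M\setminus\Gamma_{II}$ there is a homeomorphism from the closed 2-dimensional disk onto the closure of the component that takes the open disk onto the component; and the boundary of every such component is a directed cycle of $\Gamma_{II}$; (3) every connected component of $M\setminus\Gamma_{II}$ is homeomorphic to an open 2-dimensional disk. -/

import Mathlib

namespace ZTri

/-! ### Triangulations of closed surfaces -/

section Triangulation

variable {V : Type*}

/-- The link of the vertex `v`: its vertices are the neighbours of `v`, and two of them are joined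
when they lie together with `v` in a face. -/
def linkGraph (G : SimpleGraph V) (faces : Finset (Finset V)) (v : V) :
    SimpleGraph {w : V // G.Adj v w} where
  Adj w w' := w ≠ w' ∧ ∃ F ∈ faces, v ∈ F ∧ (w : V) ∈ F ∧ (w' : V) ∈ F
  symm := ⟨by
    rintro w w' ⟨h, F, hF, hv, hw, hw'⟩
    exact ⟨h.symm, F, hF, hv, hw', hw⟩⟩
  loopless := ⟨fun _ h => h.1 rfl⟩

/-- The union, in `ℝ^V`, of the geometric triangles spanned by the given faces. -/
def realization [Fintype V] (faces : Finset (Finset V)) : Set (V → ℝ) :=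
  {x | x ∈ stdSimplex ℝ V ∧ ∃ F ∈ faces, ∀ v, v ∉ F → x v = 0}

/-- A triangulation of `M`: a finite connected simple graph drawn in `M`, all of whose faces are
triangles. A face is given by its three vertices. The surface is glued from the triangles along
their sides: every edge lies on exactly two faces, and the faces at a vertex form one cyclic
sequence (the link, which is 2-regular by the condition on edges, is connected). -/
structure Triangulation (V : Type*) [Fintype V] [DecidableEq V] (M : Type*)
    [TopologicalSpace M] where
  /-- the graph -/
  graph : SimpleGraph V
  /-- the faces -/
  faces : Finset (Finset V)
  connected : graph.Connected
  isNClique_face : ∀ F ∈ faces, graph.IsNClique 3 F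
  card_faces_of_adj : ∀ u v, graph.Adj u v → (faces.filter fun F => u ∈ F ∧ v ∈ F).card = 2
  link_connected : ∀ v, (linkGraph graph faces v).Connected
  /-- the identification of the glued triangles with `M` -/
  homeo : realization faces ≃ₜ M

end Triangulation

namespace Triangulation

variable {V : Type*} [Fintype V] [DecidableEq V] {M : Type*} [TopologicalSpace M]

/-- The closed edge of the drawn graph with ends `u` and `v`, as a subset of `M`. For `u = v` this
is the vertex `u`. -/
def segment (T : Triangulation V M) (u v : V) : Set M :=
  T.homeo '' {x | ∀ w, w ≠ u → w ≠ v → (x : V → ℝ) w = 0}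

theorem exists_face (T : Triangulation V M) (v : V) : ∃ F ∈ T.faces, v ∈ F := by
  obtain ⟨⟨w, hw⟩⟩ := (T.link_connected v).nonempty
  have h := T.card_faces_of_adj v w hw
  obtain ⟨F, hF⟩ := Finset.card_pos.mp (by rw [h]; norm_num)
  exact ⟨F, (Finset.mem_filter.mp hF).1, (Finset.mem_filter.mp hF).2.1⟩

/-- The point of `M` at which the vertex `v` is drawn. -/
noncomputable def point (T : Triangulation V M) (v : V) : M :=
  T.homeo ⟨Pi.single v 1, single_mem_stdSimplex ℝ v, by
    obtain ⟨F, hF, hv⟩ := T.exists_face v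
    exact ⟨F, hF, fun w hw => Pi.single_eq_of_ne (by rintro rfl; exact hw hv) _⟩⟩

/-- `e` is an edge of the face `F`. -/
def IsEdgeOf (T : Triangulation V M) (e : Sym2 V) (F : Finset V) : Prop :=
  e ∈ T.graph.edgeSet ∧ ∀ v ∈ e, v ∈ F

/-- A zigzag. Zigzags are periodic, so they are regarded as two-way infinite sequences. -/
def IsZigzag (T : Triangulation V M) (Z : ℤ → Sym2 V) : Prop :=
  ∀ i : ℤ, Z i ≠ Z (i + 1) ∧
    (∃ F ∈ T.faces, ∃ F' ∈ T.faces, F ≠ F' ∧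
      T.IsEdgeOf (Z i) F ∧ T.IsEdgeOf (Z (i + 1)) F ∧
      T.IsEdgeOf (Z (i + 1)) F' ∧ T.IsEdgeOf (Z (i + 2)) F') ∧
    ∀ v ∈ Z i, v ∉ Z (i + 2)

end Triangulation

/-- The reversed sequence. -/
def reverse {V : Type*} (Z : ℤ → Sym2 V) : ℤ → Sym2 V := fun i => Z (-i)

/-- At its `i`-th step the zigzag `Z` goes through the edge `uv` from `u` to `v`: it enters the
edge at the common vertex with the previous edge and leaves it at the common vertex with the next
one. -/
def PassesAt {V : Type*} (Z : ℤ → Sym2 V) (i : ℤ) (u v : V) : Prop :=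
  Z i = s(u, v) ∧ u ∈ Z (i - 1) ∧ v ∈ Z (i + 1)

section ZOrientation

variable {V : Type*} [Fintype V] [DecidableEq V] {M : Type*} [TopologicalSpace M]

/-- A z-orientation: of any two mutually reversed zigzags exactly one is chosen. A zigzag is a
cyclic sequence, so the chosen set of sequences is closed under shifts. -/
structure ZOrientation (T : Triangulation V M) where
  /-- the chosen zigzags, with all their shifts -/
  zigzags : Set (ℤ → Sym2 V)
  isZigzag : ∀ Z ∈ zigzags, T.IsZigzag Z
  shift_mem : ∀ Z ∈ zigzags, ∀ k : ℤ, (fun i => Z (i + k)) ∈ zigzags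
  xor_reverse : ∀ Z, T.IsZigzag Z → Xor (Z ∈ zigzags) (reverse Z ∈ zigzags)

end ZOrientation

/-! ### Digraphs drawn in a space -/

/-- A digraph with its drawing: a point for every vertex and a subset of `M` for every arc. -/
structure DrawnDigraph (W : Type*) (M : Type*) where
  /-- the digraph -/
  digraph : Digraph W
  /-- the point at which a vertex is drawn -/
  point : W → M
  /-- the curve along which an arc is drawn -/
  curve : W → W → Set M

namespace DrawnDigraph

variable {W M : Type*}

/-- No loops, and at most one arc between two vertices. (Parallel arcs in the same direction do
not exist in a `Digraph`.) -/
def IsSimple (D : DrawnDigraph W M) : Prop :=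
  (∀ u, ¬ D.digraph.Adj u u) ∧ ∀ u v, D.digraph.Adj u v → ¬ D.digraph.Adj v u

/-- A connected digraph in which every vertex has as many entering arcs as leaving arcs. -/
def IsEulerian (D : DrawnDigraph W M) : Prop :=
  (SimpleGraph.fromRel D.digraph.Adj).Connected ∧
    ∀ v, {w | D.digraph.Adj w v}.ncard = {w | D.digraph.Adj v w}.ncard

/-- The subset of `M` occupied by the drawing. -/
def carrier (D : DrawnDigraph W M) : Set M :=
  Set.range D.point ∪ ⋃ (u : W) (v : W) (_ : D.digraph.Adj u v), D.curve u v

variable [TopologicalSpace M]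

/-- The drawing is an embedding: distinct vertices are drawn at distinct points, every arc is
drawn along a simple curve that joins its ends and contains no other vertex, and the curves of
two distinct arcs meet only at vertices. -/
def IsEmbedded (D : DrawnDigraph W M) : Prop :=
  Function.Injective D.point ∧
    (∀ u v, D.digraph.Adj u v → ∃ γ : unitInterval → M, Topology.IsEmbedding γ ∧
      γ 0 = D.point u ∧ γ 1 = D.point v ∧ Set.range γ = D.curve u v) ∧
    (∀ u v w, D.digraph.Adj u v → D.point w ∈ D.curve u v → w = u ∨ w = v) ∧
    ∀ u v u' v', D.digraph.Adj u v → D.digraph.Adj u' v' → (u, v) ≠ (u', v') →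
      D.curve u v ∩ D.curve u' v' ⊆ Set.range D.point

/-- `F` is a face: a connected component of the complement of the drawing. -/
def IsFace (D : DrawnDigraph W M) (F : Set M) : Prop :=
  ∃ p ∈ D.carrierᶜ, F = connectedComponentIn D.carrierᶜ p

/-- A closed 2-cell embedding: the closure of every face is a closed disk whose interior is the
face. -/
def IsClosedTwoCellEmbedding (D : DrawnDigraph W M) : Prop :=
  D.IsEmbedded ∧ ∀ F, D.IsFace F →
    ∃ φ : Metric.closedBall (0 : EuclideanSpace ℝ (Fin 2)) 1 ≃ₜ closure F,
      ∀ x, (φ x : M) ∈ F ↔ (x : EuclideanSpace ℝ (Fin 2)) ∈ Metric.ball 0 1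

/-- The boundary of `F` is a directed cycle of the drawn digraph. Indices are cyclic. -/
def IsBoundedByDirectedCycle (D : DrawnDigraph W M) (F : Set M) : Prop :=
  ∃ (n : ℕ) (c : Fin (n + 1) → W), Function.Injective c ∧
    (∀ i, D.digraph.Adj (c i) (c (i + 1))) ∧
    frontier F = ⋃ i, D.curve (c i) (c (i + 1))

end DrawnDigraph

/-! ### Types of edges and faces -/

namespace ZOrientation

variable {V : Type*} [Fintype V] [DecidableEq V] {M : Type*} [TopologicalSpace M]
  {T : Triangulation V M}

/-- Some zigzag of the z-orientation goes through the edge `uv` from `u` to `v`. -/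
def Passes (τ : ZOrientation T) (u v : V) : Prop :=
  ∃ Z ∈ τ.zigzags, ∃ i, PassesAt Z i u v

/-- An edge of type I: the two passages of the z-orientation through it have different
directions. -/
def IsTypeI (τ : ZOrientation T) (e : Sym2 V) : Prop :=
  e ∈ T.graph.edgeSet ∧ ∃ u v, e = s(u, v) ∧ τ.Passes u v ∧ τ.Passes v u

/-- An edge of type II: both passages have the same direction. -/
def IsTypeII (τ : ZOrientation T) (e : Sym2 V) : Prop :=
  e ∈ T.graph.edgeSet ∧ ¬ τ.IsTypeI e

/-- A vertex of type II: it belongs to an edge of type II. -/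
def IsTypeIIVertex (τ : ZOrientation T) (v : V) : Prop :=
  ∃ e, τ.IsTypeII e ∧ v ∈ e

/-- A face of type I: two of its edges are of type I and the third one is of type II. -/
def IsTypeIFace (τ : ZOrientation T) (F : Finset V) : Prop :=
  ∃ a b c, F = {a, b, c} ∧ τ.IsTypeI s(a, b) ∧ τ.IsTypeI s(a, c) ∧ τ.IsTypeII s(b, c)

/-- A homogeneous zigzag: a cyclic sequence of triples consisting of an edge of type II followed
by two edges of type I. -/
def IsHomogeneous (τ : ZOrientation T) (Z : ℤ → Sym2 V) : Prop :=
  ∃ j : ℤ, ∀ i : ℤ, τ.IsTypeII (Z (3 * i + j)) ∧ τ.IsTypeI (Z (3 * i + j + 1)) ∧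
    τ.IsTypeI (Z (3 * i + j + 2))

/-- `Γ_II`: the vertices and the edges of type II, drawn as in the triangulation, every edge being
directed as the z-orientation passes through it. -/
noncomputable def gammaII (τ : ZOrientation T) : DrawnDigraph {v : V // τ.IsTypeIIVertex v} M where
  digraph := { Adj := fun u v => τ.IsTypeII s((u : V), (v : V)) ∧ τ.Passes u v }
  point v := T.point v
  curve u v := T.segment u v

end ZOrientation

end ZTri

/-! Call the common end of the two type I edges of a face its apex; the side opposite to it is the
type II edge. All three conditions are equivalent to one combinatorial statement, `IsSeparated`: no
apex lies on Γ_II.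

Let the zigzags be homogeneous, and let a be the apex of a face abc. The zigzag through b, a, c
passes two edges of type I, so its next edge cd is of type II, and the face acd has apex a again.
Going around the link, all faces at a have apex a, so no edge at a is of type II
(`isSeparated_of_isHomogeneous`). Conversely, separation leaves exactly one vertex of every face off
Γ_II, and these vertices recur with period three along each zigzag (`IsSeparated.isHomogeneous`).

Under separation the components of the complement are the open stars of the vertices off Γ_II. The
link of such a vertex is a directed cycle of type II edges, and its closed star is the cone over
that cycle, hence a closed disk (`IsSeparated.exists_homeomorph_closedStar`). Turning about the
apexes matches the faces whose arc enters a given vertex with those whose arc leaves it, so Γ_II is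
Eulerian. This gives (2), and (2) gives (3) by restricting the homeomorphisms to open disks.

The topological core is that (3) implies separation (`isSeparated_of_homeomorph_ball`). Suppose that
the apex a of a face abc lies on Γ_II. Off Γ_II the triangle abc loses the point a and the side bc,
so it can be wrapped once around a circle while all other triangles go to the base point. On a
component that is an open disk this map lifts to a real function. The lift differs by one between
the midpoints of ab and ac, but takes equal values at the midpoints of the two type I edges of any
other face. Hence the type I edges on which the lift has its value at the midpoint of ab meet abc in
one edge and every other face in zero or two. Since every edge lies on two faces, the number of
incidences is even, a contradiction. -/

namespace ZTri.Triangulation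

/-! ### Zigzags as sequences of vertices -/

variable {V : Type*} [Fintype V] [DecidableEq V] {M : Type*} [TopologicalSpace M]
  {T : Triangulation V M}

/-- The vertices `a`, `b`, `c` form a face. -/
def Tri (T : Triangulation V M) (a b c : V) : Prop := ({a, b, c} : Finset V) ∈ T.faces

theorem Tri.rotate {a b c : V} (h : T.Tri a b c) : T.Tri b c a := by
  have : ({b, c, a} : Finset V) = {a, b, c} := by ext; simp; tauto
  rwa [Tri, this]

theorem Tri.reverse {a b c : V} (h : T.Tri a b c) : T.Tri c b a := by
  have : ({c, b, a} : Finset V) = {a, b, c} := by ext; simp; tauto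
  rwa [Tri, this]

theorem Tri.swap_left {a b c : V} (h : T.Tri a b c) : T.Tri b a c := h.rotate.rotate.reverse

theorem Tri.swap_right {a b c : V} (h : T.Tri a b c) : T.Tri a c b := h.rotate.reverse

theorem Tri.adj {a b c : V} (h : T.Tri a b c) :
    T.graph.Adj a b ∧ T.graph.Adj a c ∧ T.graph.Adj b c :=
  SimpleGraph.is3Clique_triple_iff.mp (T.isNClique_face _ h)

theorem Tri.ne {a b c : V} (h : T.Tri a b c) : a ≠ b ∧ a ≠ c ∧ b ≠ c :=
  ⟨h.adj.1.ne, h.adj.2.1.ne, h.adj.2.2.ne⟩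

theorem exists_eq_insert {F : Finset V} (hF : F ∈ T.faces) {u v : V} (hu : u ∈ F) (hv : v ∈ F)
    (huv : u ≠ v) : ∃ w, F = {w, u, v} ∧ T.Tri w u v := by
  have h3 := (T.isNClique_face F hF).card_eq
  obtain ⟨w, hw⟩ : (F \ {u, v}).Nonempty := by
    rw [← Finset.card_pos, Finset.card_sdiff_of_subset (by
      intro x; simp only [Finset.mem_insert, Finset.mem_singleton]; rintro (rfl | rfl) <;> assumption),
      Finset.card_pair huv]
    omega
  simp only [Finset.mem_sdiff, Finset.mem_insert, Finset.mem_singleton, not_or] at hw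
  have hsub : ({w, u, v} : Finset V) ⊆ F := by
    intro x; simp only [Finset.mem_insert, Finset.mem_singleton]
    rintro (rfl | rfl | rfl)
    exacts [hw.1, hu, hv]
  have : ({w, u, v} : Finset V) = F := by
    refine Finset.eq_of_subset_of_card_le hsub ?_
    rw [Finset.card_eq_three.mpr ⟨w, u, v, hw.2.1, hw.2.2, huv, rfl⟩, h3]
  exact ⟨w, this.symm, by rwa [Tri, this]⟩

theorem Tri.exists_opposite {a b c : V} (h : T.Tri a b c) :
    ∃ d, d ≠ a ∧ T.Tri d b c ∧ ∀ e, T.Tri e b c → e = a ∨ e = d := by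
  have h2 := T.card_faces_of_adj b c h.adj.2.2
  have hbc := h.ne.2.2
  have hmem : ({a, b, c} : Finset V) ∈ T.faces.filter fun F => b ∈ F ∧ c ∈ F := by
    simp only [Finset.mem_filter]; exact ⟨h, by simp, by simp⟩
  obtain ⟨F, hF, hne⟩ := Finset.exists_mem_ne (by omega) ({a, b, c} : Finset V)
    (s := T.faces.filter fun F => b ∈ F ∧ c ∈ F)
  obtain ⟨hFT, hb, hc⟩ := by simpa only [Finset.mem_filter] using hF
  obtain ⟨d, rfl, hd⟩ := exists_eq_insert hFT hb hc hbc
  refine ⟨d, by rintro rfl; exact hne rfl, hd, fun e he => ?_⟩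
  by_contra! hcon
  have hinj : ∀ {x y : V}, x ≠ y → x ≠ b → x ≠ c → ({x, b, c} : Finset V) ≠ {y, b, c} := by
    intro x y h1 h2 h3 h4
    have : x ∈ ({y, b, c} : Finset V) := h4 ▸ by simp
    simp only [Finset.mem_insert, Finset.mem_singleton] at this
    tauto
  have hsub : ({{a, b, c}, {d, b, c}, {e, b, c}} : Finset (Finset V)) ⊆
      T.faces.filter fun F => b ∈ F ∧ c ∈ F := by
    intro X
    simp only [Finset.mem_insert, Finset.mem_singleton, Finset.mem_filter]
    rintro (rfl | rfl | rfl)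
    exacts [⟨h, by simp, by simp⟩, ⟨hd, by simp, by simp⟩, ⟨he, by simp, by simp⟩]
  have := Finset.card_le_card hsub
  rw [h2, Finset.card_eq_three.mpr ⟨_, _, _, (Ne.symm hne),
    (hinj hcon.1 he.ne.1 he.ne.2.1).symm, (hinj hcon.2 he.ne.1 he.ne.2.1).symm, rfl⟩] at this
  omega

theorem exists_tri_of_adj {u v : V} (h : T.graph.Adj u v) : ∃ w, T.Tri w u v := by
  obtain ⟨F, hF⟩ := Finset.card_pos.mp (by rw [T.card_faces_of_adj u v h]; norm_num)
  obtain ⟨hFT, hu, hv⟩ := by simpa only [Finset.mem_filter] using hF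
  obtain ⟨w, -, hw⟩ := exists_eq_insert hFT hu hv h.ne
  exact ⟨w, hw⟩

/-- Two faces on the same edge as a given one coincide if they both differ from it. -/
theorem Tri.opposite_unique {a b c d e : V} (h : T.Tri a b c) (hd : T.Tri d b c)
    (he : T.Tri e b c) (hda : d ≠ a) (hea : e ≠ a) : d = e := by
  obtain ⟨f, -, -, hf⟩ := h.exists_opposite
  rcases hf d hd with rfl | rfl
  · exact absurd rfl hda
  rcases hf e he with rfl | rfl
  · exact absurd rfl hea
  rfl

/-- The sequence of vertices traversed by a zigzag. -/
def IsWalk (T : Triangulation V M) (x : ℤ → V) : Prop :=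
  ∀ i, T.Tri (x i) (x (i + 1)) (x (i + 2)) ∧ x i ≠ x (i + 3)

theorem IsWalk.shift {x : ℤ → V} (h : T.IsWalk x) (k : ℤ) : T.IsWalk fun i => x (i + k) := by
  intro i
  have := h (i + k)
  simp only [add_right_comm i k] at this
  exact this

theorem IsWalk.reverse {x : ℤ → V} (h : T.IsWalk x) (k : ℤ) : T.IsWalk fun i => x (k - i) := by
  intro i
  refine ⟨?_, ?_⟩
  · have := (h (k - i - 2)).1.reverse
    rwa [show k - i - 2 + 2 = k - i by ring, show k - i - 2 + 1 = k - (i + 1) by ring,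
      show k - i - 2 = k - (i + 2) by ring] at this
  · have := (h (k - i - 3)).2.symm
    rwa [show k - i - 3 + 3 = k - i by ring, show k - i - 3 = k - (i + 3) by ring] at this

/-- The edges of a sequence of vertices. -/
def trace (x : ℤ → V) : ℤ → Sym2 V := fun i => s(x i, x (i + 1))

theorem IsWalk.isZigzag {x : ℤ → V} (h : T.IsWalk x) : T.IsZigzag (trace x) := by
  intro i
  have h0 := h i
  have h1 := h (i + 1)
  simp only [add_assoc, Int.reduceAdd] at h1
  obtain ⟨t0, n0⟩ := h0
  obtain ⟨t1, -⟩ := h1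
  have d0 := t0.ne
  have d1 := t1.ne
  simp only [trace, add_assoc, Int.reduceAdd]
  refine ⟨?_, ⟨_, t0, _, t1, ?_, ?_, ?_, ?_, ?_⟩, ?_⟩
  · intro he
    rw [Sym2.eq_iff] at he
    tauto
  · intro he
    have : x i ∈ ({x (i + 1), x (i + 2), x (i + 3)} : Finset V) := he ▸ by simp
    simp only [Finset.mem_insert, Finset.mem_singleton] at this
    tauto
  · exact ⟨t0.adj.1, by simp⟩
  · exact ⟨t0.adj.2.2, by simp⟩
  · exact ⟨t1.adj.1, by simp⟩
  · exact ⟨t1.adj.2.2, by simp⟩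
  · simp only [Sym2.mem_iff]
    rintro v (rfl | rfl) <;> tauto

/-- Consecutive edges of a zigzag share a vertex, and these shared vertices form the walk. -/
theorem IsZigzag.exists_walk {Z : ℤ → Sym2 V} (h : T.IsZigzag Z) :
    ∃ x, T.IsWalk x ∧ Z = trace x := by
  -- Two disjoint edges of one face would need four vertices.
  have key : ∀ i, ∃ v, v ∈ Z i ∧ v ∈ Z (i + 1) := by
    intro i
    obtain ⟨hne, ⟨F, hF, -, -, -, h1, h2, -⟩, -⟩ := h i
    by_contra! hcon
    have h3 := (T.isNClique_face F hF).card_eq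
    have : (Z i).toFinset ∪ (Z (i + 1)).toFinset ⊆ F := by
      intro v
      simp only [Finset.mem_union, Sym2.mem_toFinset]
      rintro (hv | hv)
      exacts [h1.2 v hv, h2.2 v hv]
    have hc := Finset.card_le_card this
    rw [Finset.card_union_of_disjoint (by
        rw [Finset.disjoint_left]; simpa only [Sym2.mem_toFinset] using hcon),
      Sym2.card_toFinset_of_not_isDiag _ (T.graph.not_isDiag_of_mem_edgeSet h1.1),
      Sym2.card_toFinset_of_not_isDiag _ (T.graph.not_isDiag_of_mem_edgeSet h2.1)] at hc
    omega
  choose y hy hy' using key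
  have hyy : ∀ i, y i ≠ y (i + 1) := by
    intro i he
    apply (h i).2.2 _ (hy i)
    have := hy' (i + 1)
    rwa [add_assoc, ← he] at this
  have hZ : ∀ i, Z (i + 1) = s(y i, y (i + 1)) := fun i =>
    (Sym2.mem_and_mem_iff (hyy i)).mp ⟨hy' i, hy (i + 1)⟩
  -- The vertex `y i` is the end of `Z i`, whereas `trace` indexes an edge by its beginning; hence
  -- the shift by one.
  refine ⟨fun i => y (i - 1), fun i => ?_, funext fun i => ?_⟩
  · have e0 := hZ (i - 1)
    have e1 := hZ i
    have e2 := hZ (i + 1)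
    simp only [sub_add_cancel, add_assoc, Int.reduceAdd] at e0 e1 e2
    simp only [show i + 1 - 1 = i by ring, show i + 2 - 1 = i + 1 by ring,
      show i + 3 - 1 = i + 2 by ring]
    obtain ⟨hne, ⟨F, hF, -, -, -, h1, h2, -⟩, hd⟩ := h i
    rw [e0] at h1 hd hne
    rw [e1] at h2 hne
    rw [e2] at hd
    have n1 : y (i - 1) ≠ y (i + 1) := by
      intro he
      rw [he] at hne
      exact hne (Sym2.eq_swap)
    obtain ⟨w, rfl, hw⟩ := exists_eq_insert hF (h1.2 (y i) (by simp)) (h2.2 (y (i + 1)) (by simp))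
      (hyy i)
    have hm := h1.2 (y (i - 1)) (by simp)
    simp only [Finset.mem_insert, Finset.mem_singleton] at hm
    have n2 := hyy (i - 1)
    rw [sub_add_cancel] at n2
    rcases hm with hm | hm | hm
    · rw [hm]
      refine ⟨hw, ?_⟩
      have := hd (y (i - 1)) (by simp)
      rw [hm] at this
      simp only [Sym2.mem_iff, not_or] at this
      exact this.2
    · exact absurd hm n2
    · exact absurd hm n1
  · have := hZ (i - 1)
    simp only [sub_add_cancel] at this
    simp only [trace]
    rw [this, show i + 1 - 1 = i by ring]

/-- Three consecutive vertices determine the next and the previous one, since only one further face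
lies on an edge of a given face. -/
theorem IsWalk.eq_of_eq {x y : ℤ → V} (hx : T.IsWalk x) (hy : T.IsWalk y) {k : ℤ}
    (h0 : x k = y k) (h1 : x (k + 1) = y (k + 1)) (h2 : x (k + 2) = y (k + 2)) : x = y := by
  have key : ∀ i, x i = y i ∧ x (i + 1) = y (i + 1) ∧ x (i + 2) = y (i + 2) := by
    intro i
    induction i using Int.inductionOn' (b := k) with
    | zero => exact ⟨h0, h1, h2⟩
    | succ i _ ih =>
      obtain ⟨a0, a1, a2⟩ := ih
      have ax := hx (i + 1)
      have ay := hy (i + 1)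
      have bx := hx i
      have by' := hy i
      simp only [add_assoc, Int.reduceAdd] at ax ay ⊢
      refine ⟨a1, a2, ?_⟩
      rw [← a1, ← a2] at ay
      rw [← a0] at by'
      exact bx.1.opposite_unique ax.1.rotate.rotate ay.1.rotate.rotate bx.2.symm by'.2.symm
    | pred i _ ih =>
      obtain ⟨a0, a1, a2⟩ := ih
      have ax := hx (i - 1)
      have ay := hy (i - 1)
      have bx := hx i
      rw [show i - 1 + 1 = i by ring, show i - 1 + 2 = i + 1 by ring,
        show i - 1 + 3 = i + 2 by ring] at ax ay
      rw [show i - 1 + 1 = i by ring, show i - 1 + 2 = i + 1 by ring]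
      rw [← a0, ← a1, ← a2] at ay
      exact ⟨bx.1.rotate.rotate.opposite_unique ax.1 ay.1 ax.2 ay.2, a0, a1⟩
  exact funext fun i => (key i).1

/-- Moving one step on is an injective map on the finite set of ordered faces, hence a permutation;
its integer powers produce the two-way infinite walk. -/
theorem Tri.exists_walk {a b c : V} (h : T.Tri a b c) :
    ∃ x, T.IsWalk x ∧ x 0 = a ∧ x 1 = b ∧ x 2 = c := by
  let Flag := {p : V × V × V // T.Tri p.1 p.2.1 p.2.2}
  choose opp hopp hopp' _ using fun p : Flag => p.2.exists_opposite
  let next : Flag → Flag := fun p => ⟨(p.1.2.1, p.1.2.2, opp p), (hopp' p).rotate⟩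
  have hinj : Function.Injective next := by
    rintro p q he
    have he' := congrArg Subtype.val he
    simp only [next, Prod.mk.injEq] at he'
    obtain ⟨h1, h2, h3⟩ := he'
    refine Subtype.ext (Prod.ext ?_ (Prod.ext h1 h2))
    have hq := q.2
    have hq' := (hopp q).symm
    rw [← h1, ← h2] at hq
    rw [← h3] at hq'
    exact (hopp' p).opposite_unique p.2 hq (hopp p).symm hq'
  let e : Equiv.Perm Flag := Equiv.ofBijective next (Finite.injective_iff_bijective.mp hinj)
  let p : Flag := ⟨(a, b, c), h⟩
  have hs : ∀ i : ℤ, (e ^ (i + 1)) p = next ((e ^ i) p) := by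
    intro i
    rw [add_comm, zpow_add, zpow_one]
    rfl
  have hs2 : ∀ i : ℤ, (e ^ (i + 2)) p = next (next ((e ^ i) p)) := by
    intro i
    rw [← hs, ← hs, add_assoc]
    norm_num
  have hs3 : ∀ i : ℤ, (e ^ (i + 3)) p = next (next (next ((e ^ i) p))) := by
    intro i
    rw [← hs, ← hs, ← hs, add_assoc, add_assoc]
    norm_num
  have hs0 := hs 0
  have hs20 := hs2 0
  simp only [zero_add, zpow_zero, Equiv.Perm.coe_one, id_eq] at hs0 hs20
  refine ⟨fun i => ((e ^ i) p).1.1, fun i => ?_, ?_, ?_, ?_⟩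
  · simp only [hs, hs2, hs3]
    exact ⟨((e ^ i) p).2, (hopp ((e ^ i) p)).symm⟩
  · simp [p]
  · simp only [hs0]; rfl
  · simp only [hs20]; rfl

end ZTri.Triangulation

namespace ZTri.Triangulation

variable {V : Type*} [Fintype V] [DecidableEq V] {M : Type*} [TopologicalSpace M]
  {T : Triangulation V M}

/-- Connectedness of the link, as an induction principle: a property that spreads across the faces
at `a` holds at all neighbours of `a`. -/
theorem link_induction {a : V} {Q : V → Prop} {b : V} (hab : T.graph.Adj a b) (hb : Q b)
    (step : ∀ w w', T.Tri a w w' → Q w → Q w') {w : V} (haw : T.graph.Adj a w) : Q w := by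
  obtain ⟨p⟩ := (T.link_connected a).preconnected ⟨b, hab⟩ ⟨w, haw⟩
  have key : ∀ {u v : {w : V // T.graph.Adj a w}} (_ : (linkGraph T.graph T.faces a).Walk u v),
      Q u → Q v := by
    intro u v p
    induction p with
    | nil => exact id
    | @cons u v w h _ ih =>
      intro hu
      obtain ⟨hne, F, hF, ha, hu', hv'⟩ := h
      obtain ⟨z, rfl, hz⟩ := exists_eq_insert hF hu' hv' fun he => hne (Subtype.ext he)
      simp only [Finset.mem_insert, Finset.mem_singleton] at ha
      rcases ha with rfl | ha | ha
      · exact ih (step _ _ hz hu)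
      · exact absurd ha u.2.ne
      · exact absurd ha v.2.ne
  exact key p hb

end ZTri.Triangulation

/-! ### Passages through faces, types of edges and directed faces -/

namespace ZTri.ZOrientation

open Triangulation

variable {V : Type*} [Fintype V] [DecidableEq V] {M : Type*} [TopologicalSpace M]
  {T : Triangulation V M} {τ : ZOrientation T}

/-- A zigzag of the z-orientation goes successively through the vertices `a`, `b`, `c`. -/
def Traverses (τ : ZOrientation T) (a b c : V) : Prop :=
  ∃ x, T.IsWalk x ∧ trace x ∈ τ.zigzags ∧ x 0 = a ∧ x 1 = b ∧ x 2 = c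

theorem traverses_of_walk {x : ℤ → V} (hx : T.IsWalk x) (h : trace x ∈ τ.zigzags) (k : ℤ) :
    τ.Traverses (x k) (x (k + 1)) (x (k + 2)) := by
  refine ⟨fun i => x (i + k), hx.shift k, ?_, by simp, by simp [add_comm], by simp [add_comm]⟩
  convert τ.shift_mem _ h k using 1
  funext i
  simp only [trace, add_right_comm]

theorem Traverses.tri {a b c : V} (h : τ.Traverses a b c) : T.Tri a b c := by
  obtain ⟨x, hx, -, rfl, rfl, rfl⟩ := h
  exact (hx 0).1

theorem Traverses.next {a b c d : V} (h : τ.Traverses a b c) (hd : T.Tri d b c) (hda : d ≠ a) :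
    τ.Traverses b c d := by
  obtain ⟨x, hx, hτ, rfl, rfl, rfl⟩ := h
  have h0 := hx 0
  have h1 := hx 1
  have : x 3 = d := h0.1.opposite_unique h1.1.rotate.rotate hd h0.2.symm hda
  subst this
  exact traverses_of_walk hx hτ 1

theorem Traverses.prev {a b c d : V} (h : τ.Traverses a b c) (hd : T.Tri d a b) (hdc : d ≠ c) :
    τ.Traverses d a b := by
  obtain ⟨x, hx, hτ, rfl, rfl, rfl⟩ := h
  have h0 := hx 0
  have h1 := hx (-1)
  have : x (-1) = d := h0.1.rotate.rotate.opposite_unique h1.1 hd h1.2 hdc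
  subst this
  exact traverses_of_walk hx hτ (-1)

/-- The walk through `a`, `b`, `c` is unique and its reversal is the walk through `c`, `b`, `a`, so
the z-orientation contains exactly one of the two. This turns edge types into propositional logic
within a single face. -/
theorem traverses_iff_of_tri {a b c : V} (h : T.Tri a b c) :
    τ.Traverses a b c ↔ ¬ τ.Traverses c b a := by
  obtain ⟨x, hx, h0, h1, h2⟩ := h.exists_walk
  -- Reversing the vertices agrees with reversing the edges only up to a shift, which the
  -- z-orientation permits.
  have hrev : trace (fun i => x (2 - i)) = fun i => reverse (trace x) (i + -1) := by
    funext i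
    simp only [trace, ZTri.reverse]
    rw [show -(i + -1) = 2 - (i + 1) by ring, show 2 - (i + 1) + 1 = 2 - i by ring]
    exact Sym2.eq_swap
  have hrev' : reverse (trace x) = fun i => trace (fun i => x (2 - i)) (i + 1) := by
    rw [hrev]
    funext i
    simp
  have e1 : τ.Traverses a b c ↔ trace x ∈ τ.zigzags := by
    constructor
    · rintro ⟨y, hy, hm, g0, g1, g2⟩
      rwa [hx.eq_of_eq hy (k := 0) (by simp [*]) (by simp [*]) (by simp [*])]
    · exact fun hm => ⟨x, hx, hm, h0, h1, h2⟩
  have e2 : τ.Traverses c b a ↔ trace (fun i => x (2 - i)) ∈ τ.zigzags := by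
    constructor
    · rintro ⟨y, hy, hm, g0, g1, g2⟩
      rwa [(hx.reverse 2).eq_of_eq hy (k := 0) (by simp [*]) (by simp [*]) (by simp [*])]
    · exact fun hm => ⟨_, hx.reverse 2, hm, by simp [*], by simp [*], by simp [*]⟩
  have e3 : trace (fun i => x (2 - i)) ∈ τ.zigzags ↔ reverse (trace x) ∈ τ.zigzags := by
    constructor
    · intro hm
      rw [hrev']
      exact τ.shift_mem _ hm 1
    · intro hm
      rw [hrev]
      exact τ.shift_mem _ hm (-1)
  have := τ.xor_reverse _ hx.isZigzag
  rw [e1, e2, e3]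
  rcases this with h | h <;> tauto

theorem passes_iff {u v : V} : τ.Passes u v ↔ ∃ w, τ.Traverses u v w := by
  constructor
  · rintro ⟨Z, hZ, i, h1, h2, h3⟩
    obtain ⟨x, hx, rfl⟩ := (τ.isZigzag Z hZ).exists_walk
    have t0 := hx (i - 1)
    simp only [sub_add_cancel, show i - 1 + 2 = i + 1 by ring, show i - 1 + 3 = i + 2 by ring]
      at t0
    simp only [trace, sub_add_cancel, Sym2.mem_iff, Sym2.eq_iff] at h1 h2 h3
    have n := t0.1.ne
    have : x i = u ∧ x (i + 1) = v := by
      rcases h1 with h1 | ⟨rfl, rfl⟩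
      · exact h1
      · exfalso; tauto
    obtain ⟨rfl, rfl⟩ := this
    exact ⟨_, traverses_of_walk hx hZ i⟩
  · rintro ⟨w, x, hx, hτ, rfl, rfl, rfl⟩
    exact ⟨_, hτ, 0, by simp [trace], by simp [trace], by simp [trace]⟩

/-- Each passage through an edge either comes out of a given face on that edge or goes into it, so
one face shows both passages. -/
theorem passes_iff_of_tri {a b c : V} (h : T.Tri a b c) :
    τ.Passes b c ↔ τ.Traverses a b c ∨ τ.Traverses b c a := by
  rw [passes_iff]
  constructor
  · rintro ⟨w, hw⟩
    by_cases hwa : w = a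
    · exact Or.inr (hwa ▸ hw)
    · exact Or.inl (hw.prev h (Ne.symm hwa))
  · rintro (hw | hw)
    · obtain ⟨d, hd, hd', -⟩ := h.exists_opposite
      exact ⟨d, hw.next hd' hd⟩
    · exact ⟨a, hw⟩

theorem isTypeI_iff {u v : V} :
    τ.IsTypeI s(u, v) ↔ T.graph.Adj u v ∧ τ.Passes u v ∧ τ.Passes v u := by
  constructor
  · rintro ⟨he, u', v', h, h1, h2⟩
    refine ⟨he, ?_⟩
    rcases Sym2.eq_iff.mp h with ⟨rfl, rfl⟩ | ⟨rfl, rfl⟩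
    exacts [⟨h1, h2⟩, ⟨h2, h1⟩]
  · rintro ⟨he, h1, h2⟩
    exact ⟨he, u, v, rfl, h1, h2⟩

theorem isTypeI_iff_of_tri {a b c : V} (h : T.Tri a b c) :
    τ.IsTypeI s(b, c) ↔ (τ.Traverses a b c ↔ ¬ τ.Traverses b c a) := by
  rw [isTypeI_iff, passes_iff_of_tri h, passes_iff_of_tri h.swap_right]
  have h1 := h.adj.2.2
  have h2 := traverses_iff_of_tri (τ := τ) h
  have h3 := traverses_iff_of_tri (τ := τ) h.rotate
  tauto

theorem isTypeII_iff_of_tri {a b c : V} (h : T.Tri a b c) :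
    τ.IsTypeII s(b, c) ↔ (τ.Traverses a b c ↔ τ.Traverses b c a) := by
  rw [IsTypeII, isTypeI_iff_of_tri h]
  have h1 : s(b, c) ∈ T.graph.edgeSet := h.adj.2.2
  tauto

theorem IsTypeI.not_isTypeII {e : Sym2 V} (h : τ.IsTypeI e) : ¬ τ.IsTypeII e := fun h' => h'.2 h

/-- The vertices `a`, `b`, `c` form a face of type I whose edge of type II is directed from `b`
to `c`. -/
def DirFace (τ : ZOrientation T) (a b c : V) : Prop :=
  τ.Traverses a b c ∧ τ.Traverses b c a ∧ τ.Traverses b a c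

theorem DirFace.tri {a b c : V} (h : τ.DirFace a b c) : T.Tri a b c := h.1.tri

theorem DirFace.isTypeII {a b c : V} (h : τ.DirFace a b c) : τ.IsTypeII s(b, c) :=
  (isTypeII_iff_of_tri h.tri).mpr (iff_of_true h.1 h.2.1)

theorem DirFace.passes {a b c : V} (h : τ.DirFace a b c) : τ.Passes b c :=
  passes_iff.mpr ⟨_, h.2.1⟩

theorem DirFace.isTypeI_left {a b c : V} (h : τ.DirFace a b c) : τ.IsTypeI s(a, b) := by
  rw [isTypeI_iff_of_tri h.tri.rotate.rotate]
  have := traverses_iff_of_tri (τ := τ) h.tri.rotate.rotate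
  have h1 := h.1
  have h2 := h.2.2
  tauto

theorem DirFace.isTypeI_right {a b c : V} (h : τ.DirFace a b c) : τ.IsTypeI s(a, c) := by
  rw [Sym2.eq_swap, isTypeI_iff_of_tri h.tri.rotate]
  have := traverses_iff_of_tri (τ := τ) h.tri.rotate.rotate
  have h1 := h.2.1
  have h2 := h.2.2
  tauto

theorem DirFace.isTypeIIVertex_left {a b c : V} (h : τ.DirFace a b c) : τ.IsTypeIIVertex b :=
  ⟨_, h.isTypeII, by simp⟩

theorem DirFace.isTypeIIVertex_right {a b c : V} (h : τ.DirFace a b c) : τ.IsTypeIIVertex c :=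
  ⟨_, h.isTypeII, by simp⟩

variable (hτ : ∀ F ∈ T.faces, τ.IsTypeIFace F)

include hτ

theorem exists_dirFace {F : Finset V} (hF : F ∈ T.faces) :
    ∃ a b c, F = {a, b, c} ∧ τ.DirFace a b c := by
  obtain ⟨a, b, c, rfl, h1, h2, h3⟩ := hτ F hF
  have ht : T.Tri a b c := hF
  rw [isTypeI_iff_of_tri ht.rotate.rotate] at h1
  rw [Sym2.eq_swap, isTypeI_iff_of_tri ht.rotate] at h2
  rw [isTypeII_iff_of_tri ht] at h3
  have t1 := traverses_iff_of_tri (τ := τ) ht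
  have t2 := traverses_iff_of_tri (τ := τ) ht.rotate
  have t3 := traverses_iff_of_tri (τ := τ) ht.rotate.rotate
  by_cases hb : τ.Traverses a b c
  · exact ⟨a, b, c, rfl, by unfold DirFace; tauto⟩
  · exact ⟨a, c, b, by ext; simp; tauto, by unfold DirFace; tauto⟩

theorem dirFace_cases {a b c : V} (h : T.Tri a b c) :
    τ.DirFace a b c ∨ τ.DirFace a c b ∨ τ.DirFace b a c ∨ τ.DirFace b c a ∨
      τ.DirFace c a b ∨ τ.DirFace c b a := by
  obtain ⟨x, y, z, he, hd⟩ := exists_dirFace hτ h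
  have n := hd.tri.ne
  have hx : x ∈ ({a, b, c} : Finset V) := he ▸ by simp
  have hy : y ∈ ({a, b, c} : Finset V) := he ▸ by simp
  have hz : z ∈ ({a, b, c} : Finset V) := he ▸ by simp
  simp only [Finset.mem_insert, Finset.mem_singleton] at hx hy hz
  rcases hx with rfl | rfl | rfl <;> rcases hy with rfl | rfl | rfl <;>
    rcases hz with rfl | rfl | rfl <;> tauto

theorem dirFace_of_isTypeII {a b c : V} (h : T.Tri a b c) (h2 : τ.IsTypeII s(b, c))
    (hp : τ.Passes b c) : τ.DirFace a b c := by
  rw [isTypeII_iff_of_tri h] at h2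
  rw [passes_iff_of_tri h] at hp
  have t1 := traverses_iff_of_tri (τ := τ) h
  have t2 := traverses_iff_of_tri (τ := τ) h.rotate
  have t3 := traverses_iff_of_tri (τ := τ) h.rotate.rotate
  have := dirFace_cases hτ h
  unfold DirFace at *
  tauto

theorem isTypeII_iff {u v : V} :
    τ.IsTypeII s(u, v) ↔ ∃ a, τ.DirFace a u v ∨ τ.DirFace a v u := by
  constructor
  · intro h
    obtain ⟨w, hw⟩ := exists_tri_of_adj (T := T) (u := u) (v := v) h.1
    have t1 := traverses_iff_of_tri (τ := τ) hw
    have t2 := traverses_iff_of_tri (τ := τ) hw.rotate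
    have hp : τ.Passes u v ∨ τ.Passes v u := by
      rw [passes_iff_of_tri hw, passes_iff_of_tri hw.swap_right]
      tauto
    rcases hp with hp | hp
    · exact ⟨w, Or.inl (dirFace_of_isTypeII hτ hw h hp)⟩
    · exact ⟨w, Or.inr (dirFace_of_isTypeII hτ hw.swap_right (Sym2.eq_swap ▸ h) hp)⟩
  · rintro ⟨a, h | h⟩
    · exact h.isTypeII
    · exact Sym2.eq_swap ▸ h.isTypeII

/-- The zigzag through `b`, `a`, `c` continues to `d`. As `ac` is of type I, the face `dac` is also
traversed as `c`, `a`, `d`; only the direction of the passage with middle vertex `d` remains open.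
-/
theorem DirFace.next_cases {a b c d : V} (h : τ.DirFace a b c) (hd : T.Tri d a c) (hdb : d ≠ b) :
    τ.DirFace a c d ∨ τ.DirFace c a d := by
  have h1 := h.2.2.next hd hdb
  have h2 := (isTypeI_iff_of_tri hd).mp h.isTypeI_right
  have t1 := traverses_iff_of_tri (τ := τ) hd
  have t2 := traverses_iff_of_tri (τ := τ) hd.rotate
  have t3 := traverses_iff_of_tri (τ := τ) hd.rotate.rotate
  have := dirFace_cases hτ hd
  unfold DirFace at *
  tauto

theorem DirFace.prev_cases {a b c d : V} (h : τ.DirFace a b c) (hd : T.Tri d b a) (hdc : d ≠ c) :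
    τ.DirFace a d b ∨ τ.DirFace b d a := by
  have h1 := h.2.2.prev hd hdc
  have h2 := (isTypeI_iff_of_tri hd).mp (Sym2.eq_swap ▸ h.isTypeI_left)
  have t1 := traverses_iff_of_tri (τ := τ) hd
  have t2 := traverses_iff_of_tri (τ := τ) hd.rotate
  have t3 := traverses_iff_of_tri (τ := τ) hd.rotate.rotate
  have := dirFace_cases hτ hd
  unfold DirFace at *
  tauto

/-! ### Homogeneous zigzags and separation -/

omit hτ

/-- In every face the vertex opposite to the edge of type II lies outside of `Γ_II`. -/
def IsSeparated (τ : ZOrientation T) : Prop := ∀ a b c, τ.DirFace a b c → ¬ τ.IsTypeIIVertex a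

theorem IsHomogeneous.not_three_isTypeI {Z : ℤ → Sym2 V} (h : τ.IsHomogeneous Z) (i : ℤ) :
    ¬ (τ.IsTypeI (Z i) ∧ τ.IsTypeI (Z (i + 1)) ∧ τ.IsTypeI (Z (i + 2))) := by
  obtain ⟨j, hj⟩ := h
  rintro ⟨h0, h1, h2⟩
  -- One of three consecutive indices is congruent to `j` modulo 3; the quotient rounds `(i - j) /
  -- 3` up.
  obtain ⟨q, hq⟩ : ∃ q, i = 3 * q + j ∨ i + 1 = 3 * q + j ∨ i + 2 = 3 * q + j :=
    ⟨(i - j + 2) / 3, by omega⟩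
  rcases hq with hq | hq | hq
  · exact h0.not_isTypeII (hq ▸ (hj q).1)
  · exact h1.not_isTypeII (hq ▸ (hj q).1)
  · exact h2.not_isTypeII (hq ▸ (hj q).1)

theorem not_three_isTypeI (h : ∀ Z, T.IsZigzag Z → τ.IsHomogeneous Z) {a b c d : V}
    (h1 : T.Tri a b c) (h2 : T.Tri d b c) (hda : d ≠ a) :
    ¬ (τ.IsTypeI s(a, b) ∧ τ.IsTypeI s(b, c) ∧ τ.IsTypeI s(c, d)) := by
  obtain ⟨x, hx, rfl, rfl, rfl⟩ := h1.exists_walk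
  have : x 3 = d := (hx 0).1.opposite_unique (hx 1).1.rotate.rotate h2 (hx 0).2.symm hda
  subst this
  exact (h _ hx.isZigzag).not_three_isTypeI 0

include hτ

/-- In both alternatives of `next_cases` and `prev_cases` that move the apex away from `a`, a zigzag
has three consecutive edges of type I. So the apex stays at `a` all around the link, and every edge
at `a` is of type I. -/
theorem isSeparated_of_isHomogeneous (h : ∀ Z, T.IsZigzag Z → τ.IsHomogeneous Z) :
    τ.IsSeparated := by
  have right : ∀ {a b c d}, τ.DirFace a b c → T.Tri d a c → d ≠ b → τ.DirFace a c d := by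
    intro a b c d hd ht hne
    refine (hd.next_cases hτ ht hne).resolve_right fun hcon => ?_
    exact not_three_isTypeI h hd.2.2.tri ht hne
      ⟨Sym2.eq_swap ▸ hd.isTypeI_left, hd.isTypeI_right, hcon.isTypeI_right⟩
  have left : ∀ {a b c d}, τ.DirFace a b c → T.Tri d b a → d ≠ c → τ.DirFace a d b := by
    intro a b c d hd ht hne
    refine (hd.prev_cases hτ ht hne).resolve_right fun hcon => ?_
    exact not_three_isTypeI h ht hd.tri.rotate.rotate.swap_right hne.symm
      ⟨Sym2.eq_swap ▸ hcon.isTypeI_left, hcon.isTypeI_right, hd.isTypeI_right⟩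
  rintro a b c hd ⟨e, he, hae⟩
  obtain ⟨w, rfl⟩ := hae
  obtain ⟨z, hz⟩ := link_induction (T := T) (a := a) (w := w)
    (Q := fun w => ∃ z, τ.DirFace a w z ∨ τ.DirFace a z w) hd.tri.adj.1 ⟨c, Or.inl hd⟩ (by
      rintro w w' ht ⟨z, hz | hz⟩
      · by_cases hwz : w' = z
        · exact ⟨w, Or.inr (hwz ▸ hz)⟩
        · exact ⟨w, Or.inl (left hz ht.reverse hwz)⟩
      · by_cases hwz : w' = z
        · exact ⟨w, Or.inl (hwz ▸ hz)⟩
        · exact ⟨w, Or.inr (right hz ht.reverse.swap_right hwz)⟩) he.1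
  rcases hz with hz | hz
  · exact hz.isTypeI_left.not_isTypeII he
  · exact hz.isTypeI_right.not_isTypeII he

theorem IsSeparated.cases (hs : τ.IsSeparated) {a b c : V} (h : T.Tri a b c) :
    (¬ τ.IsTypeIIVertex a ∧ τ.IsTypeIIVertex b ∧ τ.IsTypeIIVertex c) ∨
    (τ.IsTypeIIVertex a ∧ ¬ τ.IsTypeIIVertex b ∧ τ.IsTypeIIVertex c) ∨
    (τ.IsTypeIIVertex a ∧ τ.IsTypeIIVertex b ∧ ¬ τ.IsTypeIIVertex c) := by
  have := dirFace_cases hτ h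
  have key : ∀ {a b c}, τ.DirFace a b c → _ := fun h =>
    (⟨hs _ _ _ h, h.isTypeIIVertex_left, h.isTypeIIVertex_right⟩ : _ ∧ _ ∧ _)
  rcases this with h | h | h | h | h | h <;> have := key h <;> tauto

/-- Take a face on the edge: its apex is off Γ_II, so its type II side is the only side with both
ends on Γ_II. -/
theorem IsSeparated.isTypeII_iff (hs : τ.IsSeparated) {u v : V} (h : T.graph.Adj u v) :
    τ.IsTypeII s(u, v) ↔ τ.IsTypeIIVertex u ∧ τ.IsTypeIIVertex v := by
  refine ⟨fun h => ⟨⟨_, h, by simp⟩, ⟨_, h, by simp⟩⟩, fun ⟨hu, hv⟩ => ?_⟩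
  obtain ⟨w, hw⟩ := exists_tri_of_adj h
  rcases dirFace_cases hτ hw with h | h | h | h | h | h
  · exact h.isTypeII
  · exact Sym2.eq_swap ▸ h.isTypeII
  · exact absurd hu (hs _ _ _ h)
  · exact absurd hu (hs _ _ _ h)
  · exact absurd hv (hs _ _ _ h)
  · exact absurd hv (hs _ _ _ h)

theorem IsSeparated.isHomogeneous (hs : τ.IsSeparated) {Z : ℤ → Sym2 V} (hZ : T.IsZigzag Z) :
    τ.IsHomogeneous Z := by
  obtain ⟨x, hx, rfl⟩ := hZ.exists_walk
  have h3 := fun i => hs.cases hτ (hx i).1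
  -- Two successive faces of the walk share two vertices, and each face has exactly one vertex off
  -- Γ_II.
  have per : ∀ i, (¬ τ.IsTypeIIVertex (x i) ↔ ¬ τ.IsTypeIIVertex (x (i + 3))) := by
    intro i
    have h1 := h3 i
    have h2 := h3 (i + 1)
    simp only [add_assoc, Int.reduceAdd] at h2
    tauto
  obtain ⟨j, hj⟩ : ∃ j, ¬ τ.IsTypeIIVertex (x (j + 2)) := by
    rcases h3 0 with h | h | h
    · exact ⟨-2, by simpa using h.1⟩
    · exact ⟨-1, by simpa using h.2.1⟩
    · exact ⟨0, by simpa using h.2.2⟩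
  have hall : ∀ i : ℤ, ¬ τ.IsTypeIIVertex (x (3 * i + j + 2)) := by
    intro i
    induction i using Int.induction_on with
    | zero => simpa using hj
    | succ i ih =>
      rw [per] at ih
      convert ih using 3
      ring
    | pred i ih =>
      rw [per]
      convert ih using 3
      ring
  refine ⟨j, fun i => ?_⟩
  have ht := (hx (3 * i + j)).1
  have ht' := (hx (3 * i + j + 1)).1
  have hc := h3 (3 * i + j)
  have hn := hall i
  simp only [add_assoc (3 * i + j), Int.reduceAdd] at ht'
  have typeI : ∀ {u v}, T.graph.Adj u v → ¬ (τ.IsTypeIIVertex u ∧ τ.IsTypeIIVertex v) →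
      τ.IsTypeI s(u, v) := by
    intro u v huv hn
    rw [← hs.isTypeII_iff hτ huv] at hn
    by_contra hcon
    exact hn ⟨huv, hcon⟩
  simp only [trace, add_assoc (3 * i + j), Int.reduceAdd]
  refine ⟨(hs.isTypeII_iff hτ ht.adj.1).mpr (by tauto), typeI ht.adj.2.2 (by tauto),
    typeI ht'.adj.2.2 (by tauto)⟩

end ZTri.ZOrientation

/-! ### Lifting to the line and connectedness -/

/-- A continuous map from a space homeomorphic to an open disk to the circle lifts to the line. -/
theorem exists_continuousOn_lift_addCircle {X : Type*} [TopologicalSpace X] {F : Set X}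
    (e : F ≃ₜ Metric.ball (0 : EuclideanSpace ℝ (Fin 2)) 1) {f : X → AddCircle (1 : ℝ)}
    (hf : ContinuousOn f F) :
    ∃ g : X → ℝ, ContinuousOn g F ∧ ∀ x ∈ F, (g x : AddCircle (1 : ℝ)) = f x := by
  classical
  let B := Metric.ball (0 : EuclideanSpace ℝ (Fin 2)) 1
  have : ContractibleSpace B :=
    (convex_ball _ _).contractibleSpace (Metric.nonempty_ball.mpr one_pos)
  have : LocallyPathConnectedSpace B := Metric.isOpen_ball.locallyPathConnectedSpace
  let h : C(B, AddCircle (1 : ℝ)) :=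
    ⟨fun y => f (e.symm y), (continuousOn_iff_continuous_domRestrict.mp hf).comp e.symm.continuous⟩
  let y₀ : B := ⟨0, Metric.mem_ball_self one_pos⟩
  obtain ⟨r, hr⟩ := QuotientAddGroup.mk_surjective (h y₀)
  obtain ⟨G, ⟨-, hG⟩, -⟩ :=
    (AddCircle.isCoveringMap_coe (1 : ℝ)).existsUnique_continuousMap_lifts h y₀ r hr
  refine ⟨fun x => if hx : x ∈ F then G (e ⟨x, hx⟩) else 0, ?_, fun x hx => ?_⟩
  · rw [continuousOn_iff_continuous_domRestrict]
    convert G.continuous.comp e.continuous using 1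
    funext x
    simp [Set.domRestrict]
  · simp only [hx, dif_pos]
    have := congrFun hG (e ⟨x, hx⟩)
    refine this.trans ?_
    change f (e.symm (e ⟨x, hx⟩)) = f x
    rw [e.symm_apply_apply]

/-- Used to compare two real lifts of the same circle-valued map: their difference takes integer
values, which form a discrete set. -/
theorem eq_of_int_valued_of_isPreconnected {X : Type*} [TopologicalSpace X] {S : Set X}
    (hS : IsPreconnected S) {h : X → ℝ} (hc : ContinuousOn h S) (hi : ∀ x ∈ S, ∃ n : ℤ, h x = n)
    {x y : X} (hx : x ∈ S) (hy : y ∈ S) : h x = h y := by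
  refine hS.constant_of_mapsTo (T := Set.range ((↑) : ℤ → ℝ)) ?_ hc ?_ hx hy
  · exact Int.isClosedEmbedding_coe_real.isEmbedding.isDiscrete_range
  · intro x hx
    obtain ⟨n, hn⟩ := hi x hx
    exact ⟨n, hn.symm⟩

theorem subset_connectedComponentIn_of_mem {X : Type*} [TopologicalSpace X]
    {S U : Set X} {p x : X} (hS : IsPreconnected S) (hSU : S ⊆ U) (hx : x ∈ S)
    (hxp : x ∈ connectedComponentIn U p) : S ⊆ connectedComponentIn U p := by
  rw [connectedComponentIn_eq hxp]
  exact hS.subset_connectedComponentIn hx hSU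

/-! ### Barycentric coordinates on the surface -/

namespace ZTri.Triangulation

variable {V : Type*}

/-- The points of the simplex with vertices `a`, `b`, `c`. -/
def triSet (a b c : V) : Set (V → ℝ) :=
  {x | (∀ v, 0 ≤ x v) ∧ x a + x b + x c = 1 ∧ ∀ v, v ≠ a → v ≠ b → v ≠ c → x v = 0}

theorem convex_triSet (a b c : V) : Convex ℝ (triSet a b c) := by
  rintro x ⟨hx0, hx1, hx2⟩ y ⟨hy0, hy1, hy2⟩ s t hs ht hst
  refine ⟨fun v => ?_, ?_, fun v ha hb hc => ?_⟩
  · have := mul_nonneg hs (hx0 v)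
    have := mul_nonneg ht (hy0 v)
    simp only [Pi.add_apply, Pi.smul_apply, smul_eq_mul]
    linarith
  · simp only [Pi.add_apply, Pi.smul_apply, smul_eq_mul]
    linear_combination s * hx1 + t * hy1 + hst
  · simp [hx2 v ha hb hc, hy2 v ha hb hc]

variable [DecidableEq V]

/-- The edgeMidpoint of an edge. -/
noncomputable def edgeMidpoint (u v : V) : V → ℝ := Pi.single u (1 / 2) + Pi.single v (1 / 2)

theorem edgeMidpoint_comm (u v : V) : edgeMidpoint u v = edgeMidpoint v u := add_comm _ _

theorem edgeMidpoint_mem_triSet {a b c : V} (hab : a ≠ b) (hac : a ≠ c) (hbc : b ≠ c) :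
    edgeMidpoint a b ∈ triSet a b c := by
  refine ⟨fun v => ?_, ?_, fun v ha hb hc => ?_⟩
  · simp only [edgeMidpoint, Pi.add_apply, Pi.single_apply]
    split_ifs <;> norm_num
  · simp [edgeMidpoint, hab, hac.symm, hbc.symm, hab.symm]
    norm_num
  · simp [edgeMidpoint, ha, hb]

end ZTri.Triangulation

namespace ZTri.Triangulation

variable {V : Type*} [Fintype V] [DecidableEq V] {M : Type*} [TopologicalSpace M]
  {T : Triangulation V M}

/-- The barycentric coordinates of a point. -/
def coord (T : Triangulation V M) (m : M) : V → ℝ := (T.homeo.symm m : V → ℝ)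

theorem isEmbedding_coord (T : Triangulation V M) : Topology.IsEmbedding T.coord :=
  Topology.IsEmbedding.subtypeVal.comp T.homeo.symm.isEmbedding

@[fun_prop]
theorem continuous_coord : Continuous T.coord := T.isEmbedding_coord.continuous

@[fun_prop]
theorem continuous_coord_apply (v : V) : Continuous fun m => T.coord m v :=
  (continuous_apply v).comp continuous_coord

theorem coord_mem (m : M) : T.coord m ∈ realization T.faces := (T.homeo.symm m).2

theorem coord_nonneg (m : M) (v : V) : 0 ≤ T.coord m v := (coord_mem m).1.1 v

theorem exists_coord_eq {x : V → ℝ} (hx : x ∈ realization T.faces) : ∃ m, T.coord m = x :=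
  ⟨T.homeo ⟨x, hx⟩, by simp [coord]⟩

theorem image_preimage_coord {K : Set (V → ℝ)} (hK : K ⊆ realization T.faces) :
    T.coord '' (T.coord ⁻¹' K) = K := by
  rw [Set.image_preimage_eq_iff]
  intro x hx
  exact exists_coord_eq (hK hx)

theorem isPreconnected_preimage_coord {K : Set (V → ℝ)} (hK : K ⊆ realization T.faces)
    (hc : IsPreconnected K) : IsPreconnected (T.coord ⁻¹' K) := by
  rw [← T.isEmbedding_coord.isInducing.isPreconnected_image, image_preimage_coord hK]
  exact hc

theorem mem_segment {u v : V} {m : M} :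
    m ∈ T.segment u v ↔ ∀ w, w ≠ u → w ≠ v → T.coord m w = 0 := by
  constructor
  · rintro ⟨x, hx, rfl⟩
    simpa [coord] using hx
  · intro h
    exact ⟨T.homeo.symm m, h, by simp⟩

theorem coord_point (v : V) : T.coord (T.point v) = Pi.single v 1 := by
  simp [coord, point]

theorem Tri.sum_eq {a b c : V} (h : T.Tri a b c) {x : V → ℝ}
    (hx : ∀ v, v ≠ a → v ≠ b → v ≠ c → x v = 0) : ∑ v, x v = x a + x b + x c := by
  obtain ⟨h1, h2, h3⟩ := h.ne
  rw [← Finset.sum_subset (Finset.subset_univ {a, b, c})]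
  · rw [Finset.sum_insert (by simp [h1, h2]), Finset.sum_pair h3, add_assoc]
  · intro v _ hv
    simp only [Finset.mem_insert, Finset.mem_singleton, not_or] at hv
    exact hx v hv.1 hv.2.1 hv.2.2

theorem Tri.triSet_subset {a b c : V} (h : T.Tri a b c) : triSet a b c ⊆ realization T.faces := by
  rintro x ⟨h0, h1, h2⟩
  refine ⟨⟨h0, ?_⟩, _, h, fun v hv => ?_⟩
  · rw [h.sum_eq h2, h1]
  · simp only [Finset.mem_insert, Finset.mem_singleton, not_or] at hv
    exact h2 v hv.1 hv.2.1 hv.2.2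

theorem Tri.mem_triSet {a b c : V} (h : T.Tri a b c) {x : V → ℝ} (hx : x ∈ stdSimplex ℝ V)
    (h2 : ∀ v, v ∉ ({a, b, c} : Finset V) → x v = 0) : x ∈ triSet a b c := by
  have h2' : ∀ v, v ≠ a → v ≠ b → v ≠ c → x v = 0 := fun v ha hb hc => h2 v (by simp [ha, hb, hc])
  exact ⟨hx.1, by rw [← h.sum_eq h2']; exact hx.2, h2'⟩

theorem Tri.coord_mem_triSet {a b c : V} (h : T.Tri a b c) {m : M}
    (h2 : ∀ v, v ∉ ({a, b, c} : Finset V) → T.coord m v = 0) : T.coord m ∈ triSet a b c :=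
  h.mem_triSet (coord_mem m).1 h2

end ZTri.Triangulation

namespace ZTri.ZOrientation

open Triangulation

variable {V : Type*} [Fintype V] [DecidableEq V] {M : Type*} [TopologicalSpace M]
  {T : Triangulation V M} {τ : ZOrientation T}

theorem mem_carrier_iff (hτ : ∀ F ∈ T.faces, τ.IsTypeIFace F) {m : M} :
    m ∈ τ.gammaII.carrier ↔ ∃ u v, τ.IsTypeII s(u, v) ∧ m ∈ T.segment u v := by
  simp only [DrawnDigraph.carrier, Set.mem_union, Set.mem_range, Set.mem_iUnion]
  constructor
  · rintro (⟨⟨u, e, he, v, rfl⟩, rfl⟩ | ⟨⟨u, hu⟩, ⟨v, hv⟩, h, hm⟩)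
    · refine ⟨u, v, he, mem_segment.mpr fun w hw _ => ?_⟩
      change T.coord (T.point u) w = 0
      rw [coord_point, Pi.single_eq_of_ne hw]
    · exact ⟨u, v, h.1, hm⟩
  · rintro ⟨u, v, h, hm⟩
    right
    have hu : τ.IsTypeIIVertex u := ⟨_, h, by simp⟩
    have hv : τ.IsTypeIIVertex v := ⟨_, h, by simp⟩
    obtain ⟨a, ha | ha⟩ := (isTypeII_iff hτ).mp h
    · exact ⟨⟨u, hu⟩, ⟨v, hv⟩, ⟨h, ha.passes⟩, hm⟩
    · refine ⟨⟨v, hv⟩, ⟨u, hu⟩, ⟨ha.isTypeII, ha.passes⟩, ?_⟩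
      rw [mem_segment] at hm
      exact mem_segment.mpr fun w h1 h2 => hm w h2 h1

/-- A point of a drawn edge has zero coordinates away from the ends of that edge, so the only edge
that could carry `m` is `uv` itself. -/
theorem notMem_carrier (hτ : ∀ F ∈ T.faces, τ.IsTypeIFace F) {u v : V} (h : τ.IsTypeI s(u, v))
    {m : M} (hu : T.coord m u ≠ 0) (hv : T.coord m v ≠ 0) : m ∉ τ.gammaII.carrier := by
  rw [mem_carrier_iff hτ]
  rintro ⟨u', v', h2, hm⟩
  rw [mem_segment] at hm
  have huv : u ≠ v := (isTypeI_iff.mp h).1.ne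
  have h1 : u = u' ∨ u = v' := by
    by_contra! hcon
    exact hu (hm u hcon.1 hcon.2)
  have h3 : v = u' ∨ v = v' := by
    by_contra! hcon
    exact hv (hm v hcon.1 hcon.2)
  apply h.not_isTypeII
  rcases h1 with rfl | rfl <;> rcases h3 with rfl | rfl
  · exact absurd rfl huv
  · exact h2
  · exact Sym2.eq_swap ▸ h2
  · exact absurd rfl huv

end ZTri.ZOrientation

/-! ### Midlines, wrapping and the parity argument -/

namespace ZTri.Triangulation

variable {V : Type*}

/-- The segment of the triangle `abc` that joins the midpoints of the sides at `a`. -/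
def midline (a b c : V) : Set (V → ℝ) := triSet a b c ∩ {x | x a = 1 / 2}

theorem convex_midline (a b c : V) : Convex ℝ (midline a b c) := by
  refine (convex_triSet a b c).inter ?_
  rintro x (hx : x a = 1 / 2) y (hy : y a = 1 / 2) s t _ _ hst
  simp only [Set.mem_ofPred_eq, Pi.add_apply, Pi.smul_apply, smul_eq_mul, hx, hy]
  linarith

theorem edgeMidpoint_mem_midline [DecidableEq V] {a b c : V} (hab : a ≠ b) (hac : a ≠ c)
    (hbc : b ≠ c) : edgeMidpoint a b ∈ midline a b c :=
  ⟨edgeMidpoint_mem_triSet hab hac hbc, by simp [edgeMidpoint, hab]⟩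

theorem midline_comm (a b c : V) : midline a b c = midline a c b := by
  ext x
  simp only [midline, triSet, Set.mem_inter_iff, Set.mem_ofPred_eq]
  rw [add_right_comm]
  refine and_congr_left fun _ => and_congr_right fun _ => and_congr_right fun _ => ?_
  exact forall_congr' fun v => ⟨fun h h1 h2 h3 => h h1 h3 h2, fun h h1 h2 h3 => h h1 h3 h2⟩

end ZTri.Triangulation

namespace ZTri.Triangulation

variable {V : Type*} [Fintype V] [DecidableEq V] {M : Type*} [TopologicalSpace M]
  {T : Triangulation V M}

theorem isClosed_support (T : Triangulation V M) (F : Finset V) :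
    IsClosed {m | ∀ v, v ∉ F → T.coord m v = 0} := by
  simp only [Set.ofPred_forall]
  exact isClosed_iInter fun v => isClosed_iInter fun _ =>
    isClosed_eq (continuous_coord_apply v) continuous_const

/-- The number of incidences between the faces and the edges of a given set is even. -/
theorem even_sum_card_edges (T : Triangulation V M) (S : Finset (Sym2 V))
    (hS : ∀ e ∈ S, e ∈ T.graph.edgeSet) :
    Even (∑ F ∈ T.faces, (S.filter fun e => ∀ v ∈ e, v ∈ F).card) := by
  classical
  have h := Finset.sum_card_bipartiteAbove_eq_sum_card_bipartiteBelow (s := T.faces) (t := S)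
    (fun F e => ∀ v ∈ e, v ∈ F)
  simp only [Finset.bipartiteAbove, Finset.bipartiteBelow] at h
  have h2 : ∀ e ∈ S, (T.faces.filter fun F => ∀ v ∈ e, v ∈ F).card = 2 := by
    intro e he
    have := hS e he
    induction e with
    | _ u v =>
      rw [← T.card_faces_of_adj u v this]
      congr 1
      ext F
      simp
  rw [Finset.sum_congr rfl h2] at h
  simp only [Finset.sum_const, smul_eq_mul] at h
  have h3 : Even (S.card * 2) := by simp
  rw [← h] at h3
  convert h3

end ZTri.Triangulation

namespace ZTri.ZOrientation

open Triangulation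

variable {V : Type*} [Fintype V] [DecidableEq V] {M : Type*} [TopologicalSpace M]
  {T : Triangulation V M} {τ : ZOrientation T}

theorem DirFace.midline_subset (hτ : ∀ F ∈ T.faces, τ.IsTypeIFace F) {a b c : V}
    (h : τ.DirFace a b c) : T.coord ⁻¹' midline a b c ⊆ τ.gammaII.carrierᶜ := by
  rintro m ⟨⟨-, h1, -⟩, h2 : T.coord m a = 1 / 2⟩
  have ha : T.coord m a ≠ 0 := by rw [h2]; norm_num
  by_cases hb : T.coord m b = 0
  · exact notMem_carrier hτ h.isTypeI_right ha (by intro hc; rw [hb, hc, h2] at h1; norm_num at h1)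
  · exact notMem_carrier hτ h.isTypeI_left ha hb

/-- The map that wraps the triangle `abc` around the circle, from the side `ac` to the side `ab`,
and sends the other triangles to the base point. -/
theorem DirFace.exists_wrapping (hτ : ∀ F ∈ T.faces, τ.IsTypeIFace F) {a b c : V}
    (h : τ.DirFace a b c) (ha : τ.IsTypeIIVertex a) :
    ∃ f : M → AddCircle (1 : ℝ), ContinuousOn f τ.gammaII.carrierᶜ ∧
      (∀ m, T.coord m ∈ triSet a b c →
        f m = ((T.coord m b / (T.coord m b + T.coord m c) : ℝ) : AddCircle (1 : ℝ))) ∧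
      ∀ m ∈ τ.gammaII.carrierᶜ, ∀ F ∈ T.faces, F ≠ {a, b, c} →
        (∀ v, v ∉ F → T.coord m v = 0) → f m = 0 := by
  classical
  set U := τ.gammaII.carrierᶜ with hU
  let f : M → AddCircle (1 : ℝ) := fun m => if T.coord m ∈ triSet a b c then
    ((T.coord m b / (T.coord m b + T.coord m c) : ℝ) : AddCircle (1 : ℝ)) else 0
  have hin : ∀ m, T.coord m ∈ triSet a b c →
      f m = ((T.coord m b / (T.coord m b + T.coord m c) : ℝ) : AddCircle (1 : ℝ)) :=
    fun m hm => if_pos hm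
  -- The denominator vanishes only at the vertex `a`, which lies on Γ_II by assumption.
  have hne : ∀ m ∈ U, T.coord m ∈ triSet a b c → T.coord m b + T.coord m c ≠ 0 := by
    rintro m hm ⟨h0, -, h2⟩ h3
    have hb : T.coord m b = 0 := by linarith [h0 b, h0 c]
    have hc : T.coord m c = 0 := by linarith [h0 b, h0 c]
    apply hm
    obtain ⟨e, he, v, rfl⟩ := ha
    rw [mem_carrier_iff hτ]
    refine ⟨a, v, he, mem_segment.mpr fun w hw _ => ?_⟩
    by_cases hwb : w = b
    · exact hwb ▸ hb
    by_cases hwc : w = c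
    · exact hwc ▸ hc
    exact h2 w hw hwb hwc
  have hbc : ∀ m ∈ U, T.coord m ∈ triSet a b c → T.coord m a ≠ 0 := by
    rintro m hm ⟨-, -, h2⟩ h3
    apply hm
    rw [mem_carrier_iff hτ]
    refine ⟨b, c, h.isTypeII, mem_segment.mpr fun w hwb hwc => ?_⟩
    by_cases hwa : w = a
    · exact hwa ▸ h3
    exact h2 w hwa hwb hwc
  -- A point that `abc` shares with another face lies on a side. The side `bc` belongs to Γ_II, and
  -- on the other two the quotient is 0 or 1, both of which are the base point of the circle.
  have hout : ∀ m ∈ U, ∀ F ∈ T.faces, F ≠ {a, b, c} → (∀ v, v ∉ F → T.coord m v = 0) →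
      f m = 0 := by
    intro m hm F hF hFne hsupp
    by_cases hmt : T.coord m ∈ triSet a b c
    · rw [hin m hmt]
      have hcard := (T.isNClique_face F hF).card_eq
      have hcard' := (T.isNClique_face _ h.tri).card_eq
      obtain ⟨v, hv, hvF⟩ := Finset.not_subset.mp fun hsub : ({a, b, c} : Finset V) ⊆ F =>
        hFne (Finset.eq_of_subset_of_card_le hsub (by omega)).symm
      have hv0 := hsupp v hvF
      simp only [Finset.mem_insert, Finset.mem_singleton] at hv
      rcases hv with rfl | rfl | rfl
      · exact absurd hv0 (hbc m hm hmt)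
      · simp [hv0]
      · have := hne m hm hmt
        rw [hv0, add_zero] at this ⊢
        rw [div_self this]
        exact AddCircle.coe_period 1
    · exact if_neg hmt
  refine ⟨f, ?_, hin, hout⟩
  have hclosed : ∀ F : Finset V, IsClosed {m : U | ∀ v, v ∉ F → T.coord m v = 0} := fun F =>
    (isClosed_support T F).preimage continuous_subtype_val
  rw [continuousOn_iff_continuous_domRestrict, ← continuousOn_univ]
  have hcov : (Set.univ : Set U) = {m : U | ∀ v, v ∉ ({a, b, c} : Finset V) → T.coord m v = 0} ∪
      ⋃ F ∈ T.faces.erase {a, b, c}, {m : U | ∀ v, v ∉ F → T.coord m v = 0} := by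
    refine (Set.eq_univ_of_forall fun m => ?_).symm
    obtain ⟨-, F, hF, hm⟩ := T.coord_mem m.1
    by_cases he : F = {a, b, c}
    · exact Or.inl (he ▸ hm)
    · exact Or.inr (Set.mem_biUnion (Finset.mem_erase.mpr ⟨he, hF⟩) hm)
  rw [hcov]
  refine ContinuousOn.union_of_isClosed ?_ ?_ (hclosed _)
    (Set.Finite.isClosed_biUnion (Finset.finite_toSet _) fun F _ => hclosed F)
  · refine ContinuousOn.congr (f := fun m : U => ((T.coord m b / (T.coord m b + T.coord m c) : ℝ) :
      AddCircle (1 : ℝ))) ?_ fun m hm => hin m.1 (h.tri.coord_mem_triSet hm)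
    refine (AddCircle.continuous_mk' 1).comp_continuousOn ?_
    refine ContinuousOn.div (by fun_prop) (by fun_prop) fun m hm => ?_
    exact hne m.1 m.2 (h.tri.coord_mem_triSet hm)
  · refine (continuousOn_const (c := (0 : AddCircle (1 : ℝ)))).congr fun m hm => ?_
    simp only [Set.mem_iUnion] at hm
    obtain ⟨F, hF, hm⟩ := hm
    exact hout m.1 m.2 F (Finset.mem_of_mem_erase hF) (Finset.ne_of_mem_erase hF) hm

/-- The midlines form closed curves off Γ_II, and the one through `abc` would wind once around the
circle. Counting incidences modulo two replaces following this curve from face to face. -/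
theorem isSeparated_of_homeomorph_ball (hτ : ∀ F ∈ T.faces, τ.IsTypeIFace F)
    (hball : ∀ F, τ.gammaII.IsFace F →
      Nonempty (F ≃ₜ Metric.ball (0 : EuclideanSpace ℝ (Fin 2)) 1)) : τ.IsSeparated := by
  classical
  intro a b c h ha
  obtain ⟨f, hfc, hin, hout⟩ := h.exists_wrapping hτ ha
  set U := τ.gammaII.carrierᶜ with hU
  obtain ⟨hab, hac, hbc⟩ := h.tri.ne
  have mem_ab := edgeMidpoint_mem_midline hab hac hbc
  have mem_ac : edgeMidpoint a c ∈ midline a b c :=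
    midline_comm a c b ▸ edgeMidpoint_mem_midline hac hab hbc.symm
  obtain ⟨p, hp⟩ := exists_coord_eq (h.tri.triSet_subset mem_ab.1)
  obtain ⟨q, hq⟩ := exists_coord_eq (h.tri.triSet_subset mem_ac.1)
  have hpU : p ∈ U := h.midline_subset hτ (by rwa [Set.mem_preimage, hp])
  set F := connectedComponentIn U p with hF
  have hFU : F ⊆ U := connectedComponentIn_subset U p
  have hpF : p ∈ F := mem_connectedComponentIn hpU
  obtain ⟨e⟩ := hball F ⟨p, hpU, rfl⟩
  obtain ⟨g, hgc, hg⟩ := exists_continuousOn_lift_addCircle e (hfc.mono hFU)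
  have hconn : ∀ {x y z}, τ.DirFace x y z → IsPreconnected (T.coord ⁻¹' midline x y z) :=
    fun hd => isPreconnected_preimage_coord (Set.inter_subset_left.trans hd.tri.triSet_subset)
      (convex_midline _ _ _).isPreconnected
  have hsub : ∀ {x y z m}, τ.DirFace x y z → T.coord m ∈ midline x y z → m ∈ F →
      T.coord ⁻¹' midline x y z ⊆ F := fun hd hm hmF =>
    subset_connectedComponentIn_of_mem (hconn hd) (hd.midline_subset hτ) hm hmF
  have hqF : q ∈ F := hsub h (hp ▸ mem_ab) hpF (by rwa [Set.mem_preimage, hq])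
  -- On the midline of `abc` the lift differs by a constant integer from the quotient, which is 1 at
  -- `p` and 0 at `q`.
  have hgpq : g p ≠ g q := by
    have key := eq_of_int_valued_of_isPreconnected (hconn h)
      (h := fun m => g m - T.coord m b / (T.coord m b + T.coord m c)) ?_ ?_
      (x := p) (y := q) (by rwa [Set.mem_preimage, hp]) (by rwa [Set.mem_preimage, hq])
    · simp only [hp, hq] at key
      simp only [edgeMidpoint, Pi.add_apply, Pi.single_apply, hab.symm, hac.symm, hbc, hbc.symm,
        if_true, if_false] at key
      norm_num at key
      intro he
      rw [he] at key
      linarith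
    · refine (hgc.mono (hsub h (hp ▸ mem_ab) hpF)).sub (ContinuousOn.div (by fun_prop)
        (by fun_prop) fun m hm => ?_)
      obtain ⟨⟨-, h1, -⟩, h2 : T.coord m a = 1 / 2⟩ := hm
      rw [add_assoc, h2] at h1
      intro h3
      rw [h3] at h1
      norm_num at h1
    · intro m hm
      have h1 := hg m (hsub h (hp ▸ mem_ab) hpF hm)
      rw [hin m hm.1, ← sub_eq_zero, ← AddCircle.coe_sub, AddCircle.coe_eq_zero_iff] at h1
      obtain ⟨n, hn⟩ := h1
      exact ⟨n, by simpa using hn.symm⟩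
  -- The type I edges whose midpoint lies in the component at the same level of the lift as `p`.
  let R : V → V → Prop := fun u v => τ.IsTypeI s(u, v) ∧ ∃ m ∈ F, T.coord m = edgeMidpoint u v ∧
    g m = g p
  have Rsymm : ∀ u v, R u v → R v u := fun u v ⟨h1, m, hm, h2, h3⟩ =>
    ⟨Sym2.eq_swap ▸ h1, m, hm, by rw [h2, edgeMidpoint_comm], h3⟩
  let S : Finset (Sym2 V) := Finset.univ.filter fun e => e ∈ Sym2.fromRel (r := R) ⟨Rsymm⟩
  have memS : ∀ {u v}, s(u, v) ∈ S ↔ R u v := by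
    intro u v
    simp [S]
  -- In any other face the circle-valued map is zero, so the lift takes integer values on the
  -- midline and is constant there.
  have hstep : ∀ {x y z}, τ.DirFace x y z → ({x, y, z} : Finset V) ≠ {a, b, c} →
      (R x y ↔ R x z) := by
    intro x y z hd hne
    obtain ⟨hxy, hxz, hyz⟩ := hd.tri.ne
    have mem_xy := edgeMidpoint_mem_midline hxy hxz hyz
    have mem_xz : edgeMidpoint x z ∈ midline x y z :=
      midline_comm x z y ▸ edgeMidpoint_mem_midline hxz hxy hyz.symm
    have hg0 : ∀ {m m'}, m ∈ F → T.coord m ∈ midline x y z → T.coord m' ∈ midline x y z →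
        g m = g m' := by
      intro m m' hmF hm hm'
      refine eq_of_int_valued_of_isPreconnected (hconn hd) (hgc.mono (hsub hd hm hmF)) ?_ hm hm'
      intro n hn
      have hnF := hsub hd hm hmF hn
      have h1 := hg n hnF
      rw [hout n (hFU hnF) _ hd.tri hne fun v hv => hn.1.2.2 v (by aesop) (by aesop) (by aesop),
        AddCircle.coe_eq_zero_iff] at h1
      obtain ⟨k, hk⟩ := h1
      exact ⟨k, by simpa using hk.symm⟩
    constructor
    · rintro ⟨-, m, hm, h1, h2⟩
      obtain ⟨m', hm'⟩ := exists_coord_eq (hd.tri.triSet_subset mem_xz.1)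
      refine ⟨hd.isTypeI_right, m', ?_, hm', ?_⟩
      · exact hsub hd (h1 ▸ mem_xy) hm (by rwa [Set.mem_preimage, hm'])
      · rw [← h2, hg0 hm (h1 ▸ mem_xy) (hm' ▸ mem_xz)]
    · rintro ⟨-, m, hm, h1, h2⟩
      obtain ⟨m', hm'⟩ := exists_coord_eq (hd.tri.triSet_subset mem_xy.1)
      refine ⟨hd.isTypeI_left, m', ?_, hm', ?_⟩
      · exact hsub hd (h1 ▸ mem_xz) hm (by rwa [Set.mem_preimage, hm'])
      · rw [← h2, hg0 hm (h1 ▸ mem_xz) (hm' ▸ mem_xy)]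
  have hR0 : R a b := ⟨h.isTypeI_left, p, hpF, hp, rfl⟩
  have hR1 : ¬ R a c := by
    rintro ⟨-, m, hm, h1, h2⟩
    rw [T.isEmbedding_coord.injective (h1.trans hq.symm)] at h2
    exact hgpq h2.symm
  have hSe : ∀ e ∈ S, e ∈ T.graph.edgeSet := by
    intro e
    induction e with
    | _ u v => exact fun he => (memS.mp he).1.1
  have hfilter : ∀ {x y z}, τ.DirFace x y z →
      (S.filter fun e => ∀ v ∈ e, v ∈ ({x, y, z} : Finset V)) =
        ({s(x, y), s(x, z)} : Finset (Sym2 V)).filter fun e => e ∈ S := by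
    intro x y z hd
    ext e
    induction e with
    | _ u v =>
      simp only [Finset.mem_filter, Finset.mem_insert, Finset.mem_singleton, Sym2.mem_iff,
        forall_eq_or_imp, forall_eq]
      constructor
      · rintro ⟨hS, hu, hv⟩
        refine ⟨?_, hS⟩
        have hI := (memS.mp hS).1
        have huv : u ≠ v := (isTypeI_iff.mp hI).1.ne
        have hn := hd.isTypeII
        have hn2 : τ.IsTypeII s(z, y) := Sym2.eq_swap ▸ hn
        rcases hu with rfl | rfl | rfl <;> rcases hv with rfl | rfl | rfl <;>
          first
          | exact absurd rfl huv
          | exact absurd hn hI.not_isTypeII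
          | exact absurd hn2 hI.not_isTypeII
          | simp
      · rintro ⟨hS | hS, hm⟩ <;> refine ⟨hm, ?_⟩ <;>
          rcases Sym2.eq_iff.mp hS with ⟨rfl, rfl⟩ | ⟨rfl, rfl⟩ <;> simp
  have hpair : ∀ {x y z}, τ.DirFace x y z → s(x, y) ≠ s(x, z) := by
    intro x y z hd he
    have := hd.tri.ne
    rw [Sym2.eq_iff] at he
    tauto
  have heven := even_sum_card_edges T S hSe
  rw [← Finset.add_sum_erase _ _ h.tri] at heven
  have hrest : Even (∑ F ∈ T.faces.erase {a, b, c},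
      (S.filter fun e => ∀ v ∈ e, v ∈ F).card) := by
    refine Finset.even_sum _ fun F hF => ?_
    obtain ⟨x, y, z, rfl, hd⟩ := exists_dirFace hτ (Finset.mem_of_mem_erase hF)
    rw [hfilter hd]
    have := hstep hd (Finset.ne_of_mem_erase hF)
    by_cases hR : R x y
    · rw [Finset.filter_true_of_mem, Finset.card_pair (hpair hd)]
      · exact even_two
      · simp [memS, hR, ← this]
    · rw [Finset.filter_false_of_mem, Finset.card_empty]
      · exact Even.zero
      · simp [memS, hR, ← this]
  -- The face `abc` contributes `ab` but not `ac`, so it alone makes the even total odd.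
  have hone : (S.filter fun e => ∀ v ∈ e, v ∈ ({a, b, c} : Finset V)).card = 1 := by
    rw [hfilter h, Finset.filter_insert, Finset.filter_singleton]
    simp [memS, hR0, hR1]
  rw [hone, Nat.even_add] at heven
  exact absurd (heven.mpr hrest) (by decide)

end ZTri.ZOrientation

/-! ### Γ_II as an Eulerian digraph and the links of the apexes -/

namespace ZTri.Triangulation

variable {V : Type*} [Fintype V] [DecidableEq V] {M : Type*} [TopologicalSpace M]
  {T : Triangulation V M}

/-- Every edge lies on two faces. -/
theorem card_filter_tri_and (v : V) {N : V → Prop}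
    (hN : ∀ w, N w → T.graph.Adj w v) :
    {p : V × V | T.Tri p.1 p.2 v ∧ N p.2}.ncard = {w | N w}.ncard * 2 := by
  classical
  rw [Set.ncard_eq_toFinset_card', Set.ncard_eq_toFinset_card',
    Finset.card_eq_sum_card_fiberwise (f := Prod.snd) (t := {w | N w}.toFinset)
      (fun p hp => by simp_all)]
  refine Finset.sum_const_nat fun w hw => ?_
  have hw' : N w := by simpa using hw
  obtain ⟨a, ha⟩ := exists_tri_of_adj (hN w hw')
  obtain ⟨d, hda, hd, huniq⟩ := ha.exists_opposite
  rw [Finset.card_eq_two]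
  refine ⟨(a, w), (d, w), by simpa using hda.symm, ?_⟩
  ext ⟨x, y⟩
  simp only [Finset.mem_filter, Set.mem_toFinset, Set.mem_ofPred_eq, Finset.mem_insert,
    Finset.mem_singleton, Prod.mk.injEq]
  constructor
  · rintro ⟨⟨h1, h2⟩, rfl⟩
    simpa using huniq x h1
  · rintro (⟨rfl, rfl⟩ | ⟨rfl, rfl⟩)
    exacts [⟨⟨ha, hw'⟩, rfl⟩, ⟨⟨hd, hw'⟩, rfl⟩]

end ZTri.Triangulation

namespace ZTri.ZOrientation

open Triangulation

variable {V : Type*} [Fintype V] [DecidableEq V] {M : Type*} [TopologicalSpace M]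
  {T : Triangulation V M} {τ : ZOrientation T}

theorem DirFace.not_passes {a b c : V} (h : τ.DirFace a b c) : ¬ τ.Passes c b := fun hp =>
  h.isTypeII.2 (isTypeI_iff.mpr ⟨h.tri.adj.2.2, h.passes, hp⟩)

theorem DirFace.not_swap {a b c d : V} (h : τ.DirFace a b c) : ¬ τ.DirFace d c b :=
  fun h' => h.not_passes h'.passes

theorem gammaII_isSimple : τ.gammaII.IsSimple := by
  constructor
  · rintro u ⟨h, -⟩
    exact T.graph.loopless.irrefl _ h.1
  · rintro u v ⟨h, hp⟩ ⟨-, hp'⟩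
    exact h.2 (isTypeI_iff.mpr ⟨h.1, hp, hp'⟩)

variable (hτ : ∀ F ∈ T.faces, τ.IsTypeIFace F)

include hτ

theorem fromRel_adj_of_isTypeII {u v : V} (h : τ.IsTypeII s(u, v)) (hu : τ.IsTypeIIVertex u)
    (hv : τ.IsTypeIIVertex v) :
    (SimpleGraph.fromRel τ.gammaII.digraph.Adj).Adj ⟨u, hu⟩ ⟨v, hv⟩ := by
  rw [SimpleGraph.fromRel_adj]
  have huv : T.graph.Adj u v := h.1
  refine ⟨fun he => huv.ne (congrArg Subtype.val he), ?_⟩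
  obtain ⟨a, ha | ha⟩ := (isTypeII_iff hτ).mp h
  · exact Or.inl ⟨ha.isTypeII, ha.passes⟩
  · exact Or.inr ⟨ha.isTypeII, ha.passes⟩

theorem dirFace_of_not_isTypeIIVertex {a b c : V} (h : T.Tri a b c)
    (ha : ¬ τ.IsTypeIIVertex a) : τ.DirFace a b c ∨ τ.DirFace a c b := by
  rcases dirFace_cases hτ h with h | h | h | h | h | h
  · exact Or.inl h
  · exact Or.inr h
  · exact absurd h.isTypeIIVertex_left ha
  · exact absurd h.isTypeIIVertex_right ha
  · exact absurd h.isTypeIIVertex_left ha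
  · exact absurd h.isTypeIIVertex_right ha

/-- A path of Γ is pushed into Γ_II: whenever it goes through a vertex off Γ_II, the link of that
vertex consists of type II edges and provides a detour. -/
theorem IsSeparated.gammaII_connected (hs : τ.IsSeparated) :
    (SimpleGraph.fromRel τ.gammaII.digraph.Adj).Connected := by
  obtain ⟨v⟩ := T.connected.nonempty
  obtain ⟨F, hF, -⟩ := T.exists_face v
  obtain ⟨a, b, c, -, hd⟩ := exists_dirFace hτ hF
  have : Nonempty {v : V // τ.IsTypeIIVertex v} := ⟨⟨b, hd.isTypeIIVertex_left⟩⟩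
  refine ⟨fun u₀ v₀ => ?_⟩
  let R : V → Prop := fun w =>
    ∀ hw : τ.IsTypeIIVertex w, (SimpleGraph.fromRel τ.gammaII.digraph.Adj).Reachable u₀ ⟨w, hw⟩
  have hstep : ∀ {w w'}, τ.IsTypeII s(w, w') → R w → R w' := fun {w w'} h hR hw' =>
    have hw : τ.IsTypeIIVertex w := ⟨_, h, by simp⟩
    (hR hw).trans (fromRel_adj_of_isTypeII hτ h hw hw').reachable
  -- The first part is vacuous off Γ_II, where the second one carries reachability to all neighbours
  -- instead.
  let Q : V → Prop := fun x => R x ∧ (¬ τ.IsTypeIIVertex x → ∀ w, T.graph.Adj x w → R w)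
  have hQ : ∀ {x y}, T.graph.Adj x y → Q x → Q y := by
    rintro x y hxy ⟨h1, h2⟩
    obtain ⟨w, hw⟩ := exists_tri_of_adj hxy
    have hc := hs.cases hτ hw
    have hy : R y := by
      intro hy
      by_cases hx : τ.IsTypeIIVertex x
      · exact hstep ((hs.isTypeII_iff hτ hxy).mpr ⟨hx, hy⟩) h1 hy
      · exact h2 hx y hxy hy
    refine ⟨hy, fun hyn w' hw' => ?_⟩
    refine link_induction (a := y) (Q := R) hxy.symm h1 (fun z z' ht hz => hstep ?_ hz) hw'
    rcases dirFace_of_not_isTypeIIVertex hτ ht hyn with h | h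
    · exact h.isTypeII
    · exact Sym2.eq_swap ▸ h.isTypeII
  have hwalk : ∀ {x y : V} (_ : T.graph.Walk x y), Q x → Q y := by
    intro x y p
    induction p with
    | nil => exact id
    | cons h _ ih => exact fun hx => ih (hQ h hx)
  obtain ⟨p⟩ := T.connected.preconnected u₀.1 v₀.1
  exact (hwalk p ⟨fun _ => SimpleGraph.Reachable.refl _, fun h => absurd u₀.2 h⟩).1 v₀.2

theorem IsSeparated.next (hs : τ.IsSeparated) {a b c d : V} (h : τ.DirFace a b c)
    (hd : T.Tri d a c) (hdb : d ≠ b) : τ.DirFace a c d :=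
  (h.next_cases hτ hd hdb).resolve_right fun h' => hs _ _ _ h' h.isTypeIIVertex_right

theorem IsSeparated.prev (hs : τ.IsSeparated) {a b c d : V} (h : τ.DirFace a b c)
    (hd : T.Tri d b a) (hdc : d ≠ c) : τ.DirFace a d b :=
  (h.prev_cases hτ hd hdc).resolve_right fun h' => hs _ _ _ h' h.isTypeIIVertex_left

theorem IsSeparated.exists_next (hs : τ.IsSeparated) {a b c : V} (h : τ.DirFace a b c) :
    ∃ d, τ.DirFace a c d := by
  obtain ⟨d, hd, ht, -⟩ := h.tri.swap_left.exists_opposite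
  exact ⟨d, hs.next hτ h ht hd⟩

theorem IsSeparated.exists_prev (hs : τ.IsSeparated) {a b c : V} (h : τ.DirFace a b c) :
    ∃ d, τ.DirFace a d b := by
  obtain ⟨d, hd, ht, -⟩ := h.tri.reverse.exists_opposite
  exact ⟨d, hs.prev hτ h ht hd⟩

/-- If the two faces on `ab` were different, the arc of one would enter `b` and the arc of the other
would leave it. -/
theorem IsSeparated.next_unique (hs : τ.IsSeparated) {a b c d : V} (h : τ.DirFace a b c)
    (h' : τ.DirFace a b d) : c = d := by
  by_contra hcd
  exact h'.not_swap (hs.prev hτ h h'.tri.reverse (Ne.symm hcd))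

theorem IsSeparated.prev_unique (hs : τ.IsSeparated) {a b c d : V} (h : τ.DirFace a b d)
    (h' : τ.DirFace a c d) : b = c := by
  by_contra hbc
  exact h'.not_swap (hs.next hτ h h'.tri.swap_left (Ne.symm hbc))

/-- Rotating about the apex is a bijection from the faces whose arc ends at `v` to the faces whose
arc starts at `v`. Each arc lies on two faces, so both counts are twice a degree. -/
theorem IsSeparated.gammaII_isEulerian (hs : τ.IsSeparated) : τ.gammaII.IsEulerian := by
  classical
  refine ⟨hs.gammaII_connected hτ, fun v => ?_⟩
  have hin : {w : {v : V // τ.IsTypeIIVertex v} | τ.gammaII.digraph.Adj w v}.ncard =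
      {w : V | τ.IsTypeII s(w, v.1) ∧ τ.Passes w v}.ncard := by
    rw [← Set.ncard_image_of_injective _ Subtype.val_injective]
    congr 1
    ext w
    constructor
    · rintro ⟨w, hw, rfl⟩
      exact hw
    · intro hw
      exact ⟨⟨w, _, hw.1, by simp⟩, hw, rfl⟩
  have hout : {w : {v : V // τ.IsTypeIIVertex v} | τ.gammaII.digraph.Adj v w}.ncard =
      {w : V | τ.IsTypeII s(v.1, w) ∧ τ.Passes v w}.ncard := by
    rw [← Set.ncard_image_of_injective _ Subtype.val_injective]
    congr 1
    ext w
    constructor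
    · rintro ⟨w, hw, rfl⟩
      exact hw
    · intro hw
      exact ⟨⟨w, _, hw.1, by simp⟩, hw, rfl⟩
  have h1 := T.card_filter_tri_and v.1 (N := fun w => τ.IsTypeII s(w, v.1) ∧ τ.Passes w v)
    fun w hw => hw.1.1
  have h2 := T.card_filter_tri_and v.1 (N := fun w => τ.IsTypeII s(v.1, w) ∧ τ.Passes v w)
    fun w hw => (show T.graph.Adj v w from hw.1.1).symm
  have e1 : {p : V × V | T.Tri p.1 p.2 v ∧ τ.IsTypeII s(p.2, v.1) ∧ τ.Passes p.2 v} =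
      {p : V × V | τ.DirFace p.1 p.2 v} := by
    ext p
    exact ⟨fun h => dirFace_of_isTypeII hτ h.1 h.2.1 h.2.2, fun h => ⟨h.tri, h.isTypeII, h.passes⟩⟩
  have e2 : {p : V × V | T.Tri p.1 p.2 v ∧ τ.IsTypeII s(v.1, p.2) ∧ τ.Passes v p.2} =
      {p : V × V | τ.DirFace p.1 v p.2} := by
    ext p
    exact ⟨fun h => dirFace_of_isTypeII hτ h.1.swap_right h.2.1 h.2.2,
      fun h => ⟨h.tri.swap_right, h.isTypeII, h.passes⟩⟩
  rw [e1] at h1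
  rw [e2] at h2
  have key : {p : V × V | τ.DirFace p.1 p.2 v}.ncard = {p : V × V | τ.DirFace p.1 v p.2}.ncard := by
    choose f hf using fun p : {p : V × V // τ.DirFace p.1 p.2 v} => hs.exists_next hτ p.2
    refine Set.ncard_congr (fun p hp => (p.1, f ⟨p, hp⟩)) (fun p hp => hf ⟨p, hp⟩) ?_ ?_
    · rintro ⟨a, b⟩ ⟨a', b'⟩ hp hp' he
      simp only [Prod.mk.injEq] at he
      obtain ⟨rfl, he⟩ := he
      exact Prod.ext rfl (hs.prev_unique hτ hp hp')
    · rintro ⟨a, b⟩ hp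
      obtain ⟨d, hd⟩ := hs.exists_prev hτ hp
      exact ⟨(a, d), hd, Prod.ext rfl (hs.next_unique hτ (hf ⟨(a, d), hd⟩) hp)⟩
  rw [hin, hout]
  omega

/-- The link of a vertex outside of `Γ_II` is a directed cycle. -/
theorem IsSeparated.exists_cycle (hs : τ.IsSeparated) {a : V} (ha : ¬ τ.IsTypeIIVertex a) :
    ∃ (n : ℕ) (c : ℤ → V), 3 ≤ n ∧ (∀ k l, c k = c l ↔ (n : ℤ) ∣ k - l) ∧
      (∀ k, τ.DirFace a (c k) (c (k + 1))) ∧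
      ∀ b d, τ.DirFace a b d → ∃ k, b = c k ∧ d = c (k + 1) := by
  classical
  let Nb := {w : V // ∃ z, τ.DirFace a w z}
  choose f hf using fun w : Nb => w.2
  -- The successor along the link is a permutation by `prev_unique`; connectedness of the link makes
  -- it a single cycle.
  let s : Nb → Nb := fun w => ⟨f w, hs.exists_next hτ (hf w)⟩
  have hinj : Function.Injective s := by
    intro w w' he
    have he' : f w = f w' := congrArg Subtype.val he
    exact Subtype.ext (hs.prev_unique hτ (hf w) (he' ▸ hf w'))
  let σ : Equiv.Perm Nb := Equiv.ofBijective s (Finite.injective_iff_bijective.mp hinj)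
  have hσ : ∀ w : Nb, τ.DirFace a w (σ w) := hf
  obtain ⟨F, hF, haF⟩ := T.exists_face a
  obtain ⟨x, y, z, rfl, hd⟩ := exists_dirFace hτ hF
  have hax : a = x := by
    simp only [Finset.mem_insert, Finset.mem_singleton] at haF
    rcases haF with rfl | rfl | rfl
    · rfl
    · exact absurd hd.isTypeIIVertex_left ha
    · exact absurd hd.isTypeIIVertex_right ha
  subst hax
  let w₀ : Nb := ⟨y, z, hd⟩
  have hreach : ∀ w, T.graph.Adj a w → ∃ k : ℤ, ((σ ^ k) w₀ : V) = w := by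
    intro w hw
    refine link_induction (a := a) (b := y) (Q := fun w => ∃ k : ℤ, ((σ ^ k) w₀ : V) = w)
      hd.tri.adj.1 ⟨0, rfl⟩ ?_ hw
    rintro u u' ht ⟨k, rfl⟩
    rcases dirFace_of_not_isTypeIIVertex hτ ht ha with h | h
    · refine ⟨k + 1, ?_⟩
      rw [add_comm, zpow_add, zpow_one]
      exact hs.next_unique hτ (hσ _) h
    · refine ⟨k - 1, ?_⟩
      have h1 := hσ ((σ ^ (k - 1)) w₀)
      rw [← Equiv.Perm.mul_apply, ← zpow_one_add, add_sub_cancel] at h1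
      exact hs.prev_unique hτ h1 h
  have hcyc : σ.IsCycleOn ((Finset.univ : Finset Nb) : Set Nb) := by
    refine ⟨by simp, fun u _ v _ => ?_⟩
    obtain ⟨k, hk⟩ := hreach u (hf u).tri.adj.1
    obtain ⟨l, hl⟩ := hreach v (hf v).tri.adj.1
    have h1 : σ.SameCycle w₀ u := ⟨k, Subtype.ext hk⟩
    have h2 : σ.SameCycle w₀ v := ⟨l, Subtype.ext hl⟩
    exact h1.symm.trans h2
  let n := (Finset.univ : Finset Nb).card
  let c : ℤ → V := fun k => (σ ^ k) w₀
  have hcc : ∀ k l, c k = c l ↔ (n : ℤ) ∣ k - l := by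
    intro k l
    have := hcyc.zpow_apply_eq_zpow_apply (Finset.mem_univ w₀) (m := k) (n := l)
    rw [← Int.modEq_iff_dvd.trans (dvd_sub_comm), ← this]
    exact Subtype.ext_iff.symm
  have hdir : ∀ k, τ.DirFace a (c k) (c (k + 1)) := by
    intro k
    have := hσ ((σ ^ k) w₀)
    simp only [c, add_comm k, zpow_add, zpow_one]
    exact this
  refine ⟨n, c, ?_, hcc, hdir, ?_⟩
  · have h0 : 0 < n := Finset.card_pos.mpr ⟨w₀, Finset.mem_univ _⟩
    have h1 : n ≠ 1 := by
      intro h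
      have := (hcc 0 1).mpr (by simp [h])
      exact (hdir 0).tri.ne.2.2 this
    -- A cycle of length two would contain an edge directed both ways.
    have h2 : n ≠ 2 := by
      intro h
      have := (hcc 0 2).mpr (by simp [h])
      exact (hdir 0).not_swap (this ▸ hdir 1)
    omega
  · intro b d hbd
    obtain ⟨k, hk⟩ := hreach b hbd.tri.adj.1
    refine ⟨k, hk.symm, ?_⟩
    subst hk
    exact hs.next_unique hτ hbd (hdir k)

end ZTri.ZOrientation

/-! ### Polar coordinates on the disk and on a cone over a polygon -/

/-- Two compact quotients with the same fibres are homeomorphic. -/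
theorem exists_homeomorph_of_fibers_eq {X Y Z : Type*} [TopologicalSpace X] [TopologicalSpace Y]
    [TopologicalSpace Z] [CompactSpace X] [T2Space Y] [T2Space Z] {q : X → Y} {p : X → Z}
    (hq : Continuous q) (hqs : Function.Surjective q) (hp : Continuous p)
    (hps : Function.Surjective p) (h : ∀ x y, q x = q y ↔ p x = p y) :
    ∃ φ : Y ≃ₜ Z, ∀ x, φ (q x) = p x := by
  have h1 : ∀ x, p (Function.surjInv hqs (q x)) = p x := fun x =>
    (h _ _).mp (Function.surjInv_eq hqs _)
  have h2 : ∀ x, q (Function.surjInv hps (p x)) = q x := fun x =>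
    (h _ _).mpr (Function.surjInv_eq hps _)
  refine ⟨{ toFun := fun y => p (Function.surjInv hqs y)
            invFun := fun z => q (Function.surjInv hps z)
            left_inv := fun y => ?_
            right_inv := fun z => ?_
            continuous_toFun := ?_
            continuous_invFun := ?_ }, h1⟩
  · change q (Function.surjInv hps (p (Function.surjInv hqs y))) = y
    rw [h2, Function.surjInv_eq hqs]
  · change p (Function.surjInv hqs (q (Function.surjInv hps z))) = z
    rw [h1, Function.surjInv_eq hps]
  · rw [(hq.isClosedMap.isQuotientMap hq hqs).continuous_iff]
    exact hp.congr fun x => (h1 x).symm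
  · rw [(hp.isClosedMap.isQuotientMap hp hps).continuous_iff]
    exact hq.congr fun x => (h2 x).symm

/-- The point of the unit circle at the fraction `t / n` of a full turn. -/
noncomputable def circlePoint (n : ℕ) (t : ℝ) : ℂ := Complex.exp (2 * Real.pi * (t / n) * Complex.I)

theorem norm_circlePoint (n : ℕ) (t : ℝ) : ‖circlePoint n t‖ = 1 := by
  have : (2 * Real.pi * (t / n) : ℂ) = ((2 * Real.pi * (t / n) : ℝ) : ℂ) := by push_cast; ring
  rw [circlePoint, this, Complex.norm_exp_ofReal_mul_I]

theorem circlePoint_eq_iff {n : ℕ} (hn : n ≠ 0) {s t : ℝ} :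
    circlePoint n s = circlePoint n t ↔ ∃ m : ℤ, s - t = m * n := by
  rw [circlePoint, circlePoint, Complex.exp_eq_exp_iff_exists_int]
  have hn' : (n : ℂ) ≠ 0 := by exact_mod_cast hn
  have hπ : (2 * Real.pi * Complex.I : ℂ) ≠ 0 := Complex.two_pi_I_ne_zero
  refine exists_congr fun m => ?_
  have h1 : (2 * Real.pi * (s / n) * Complex.I : ℂ) = 2 * Real.pi * (t / n) * Complex.I +
      m * (2 * Real.pi * Complex.I) ↔ (2 * Real.pi * Complex.I : ℂ) * s =
        (2 * Real.pi * Complex.I) * (t + m * n) := by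
    rw [← mul_left_inj' hn']
    have e1 : (2 * Real.pi * (s / n) * Complex.I : ℂ) * n = (2 * Real.pi * Complex.I) * s := by
      field_simp
    have e2 : (2 * Real.pi * (t / n) * Complex.I + m * (2 * Real.pi * Complex.I) : ℂ) * n =
        (2 * Real.pi * Complex.I) * (t + m * n) := by
      field_simp
    rw [e1, e2]
  rw [h1, mul_right_inj' hπ, sub_eq_iff_eq_add']
  exact_mod_cast Iff.rfl

theorem exists_circlePoint {n : ℕ} (hn : n ≠ 0) (z : ℂ) :
    ∃ (k : Fin n) (f : unitInterval), z = ‖z‖ * circlePoint n ((k : ℕ) + f) := by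
  have hn' : (n : ℂ) ≠ 0 := by exact_mod_cast hn
  have hπ : (Real.pi : ℂ) ≠ 0 := by exact_mod_cast Real.pi_ne_zero
  set t : ℝ := n * (z.arg / (2 * Real.pi)) with ht
  have hz : z = ‖z‖ * circlePoint n t := by
    have : (2 * Real.pi * (t / n) * Complex.I : ℂ) = z.arg * Complex.I := by
      rw [ht]
      push_cast
      field_simp
    rw [circlePoint, this, Complex.norm_mul_exp_arg_mul_I]
  have hpos : (0 : ℤ) < n := by omega
  have h0 := Int.emod_nonneg ⌊t⌋ hpos.ne'
  have h1 := Int.emod_lt_of_pos ⌊t⌋ hpos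
  refine ⟨⟨(⌊t⌋ % n).toNat, by omega⟩, ⟨Int.fract t, Int.fract_nonneg t, (Int.fract_lt_one t).le⟩, ?_⟩
  conv_lhs => rw [hz]
  congr 1
  rw [circlePoint_eq_iff hn]
  refine ⟨⌊t⌋ / n, ?_⟩
  have h2 : (((⌊t⌋ % n).toNat : ℕ) : ℝ) = ((⌊t⌋ % n : ℤ) : ℝ) := by
    exact_mod_cast congrArg (Int.cast : ℤ → ℝ) (Int.toNat_of_nonneg h0)
  have h3 : ((⌊t⌋ % n : ℤ) : ℝ) + n * ((⌊t⌋ / n : ℤ) : ℝ) = ⌊t⌋ := by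
    exact_mod_cast congrArg (Int.cast : ℤ → ℝ) (Int.emod_add_mul_ediv ⌊t⌋ n)
  simp only [h2]
  have h4 := Int.floor_add_fract t
  linarith

/-- The cone with apex `a` over the closed polygon with vertices `c k`, in coordinates. -/
noncomputable def conePoint {V : Type*} [DecidableEq V] (a : V) (c : ℤ → V) (r : ℝ) (k : ℤ)
    (f : ℝ) : V → ℝ :=
  Pi.single a (1 - r) + Pi.single (c k) (r * (1 - f)) + Pi.single (c (k + 1)) (r * f)

section Cone

variable {V : Type*} [DecidableEq V] {a : V} {c : ℤ → V} {n : ℕ}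

theorem conePoint_apply_apex (hac : ∀ k, a ≠ c k) (r : ℝ) (k : ℤ) (f : ℝ) :
    conePoint a c r k f a = 1 - r := by
  simp [conePoint, hac]

theorem conePoint_congr (hc : ∀ k l, c k = c l ↔ (n : ℤ) ∣ k - l) (r : ℝ) {k l : ℤ}
    (h : (n : ℤ) ∣ k - l) (f : ℝ) : conePoint a c r k f = conePoint a c r l f := by
  have h1 : c (k + 1) = c (l + 1) := (hc _ _).mpr (by rwa [add_sub_add_right_eq_sub])
  rw [conePoint, conePoint, (hc k l).mpr h, h1]

/-- These are the identifications that polar coordinates make in the disk, in the form of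
`circlePoint_eq_iff`: the radii agree, and away from the apex the angles agree modulo `n`. -/
theorem conePoint_eq_iff (hn : 3 ≤ n) (hc : ∀ k l, c k = c l ↔ (n : ℤ) ∣ k - l)
    (hac : ∀ k, a ≠ c k) {r r' f f' : ℝ} {k k' : ℤ} (hf : f ∈ Set.Icc (0 : ℝ) 1)
    (hf' : f' ∈ Set.Icc (0 : ℝ) 1) :
    conePoint a c r k f = conePoint a c r' k' f' ↔
      r = r' ∧ (r = 0 ∨ ∃ m : ℤ, (k + f) - (k' + f') = m * n) := by
  have hsucc : ∀ k, c k ≠ c (k + 1) := by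
    intro k h
    rw [hc] at h
    have := Int.le_of_dvd one_pos (show (n : ℤ) ∣ 1 by simpa using h)
    omega
  constructor
  · intro h
    have hr : r = r' := by
      have := congrFun h a
      rw [conePoint_apply_apex hac, conePoint_apply_apex hac] at this
      linarith
    subst hr
    refine ⟨rfl, or_iff_not_imp_left.mpr fun hr0 => ?_⟩
    have hv : ∀ v, v ≠ a → (if v = c k then 1 - f else 0) + (if v = c (k + 1) then f else 0) =
        (if v = c k' then 1 - f' else 0) + (if v = c (k' + 1) then f' else 0) := by
      intro v hva
      have := congrFun h v
      simp only [conePoint, Pi.add_apply, Pi.single_apply, hva, if_false, zero_add] at this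
      simp only [← mul_ite_zero, ← mul_add] at this
      exact mul_left_cancel₀ hr0 this
    have e0 := hv _ (hac k).symm
    have e1 := hv _ (hac (k + 1)).symm
    simp only [if_true, (hsucc k), (hsucc k).symm, if_false, add_zero, zero_add] at e0 e1
    by_cases h1 : c k = c k'
    · have h2 : c k ≠ c (k' + 1) := h1 ▸ hsucc k'
      rw [if_pos h1, if_neg h2] at e0
      obtain ⟨m, hm⟩ := (hc _ _).mp h1
      refine ⟨m, ?_⟩
      have hm' : (k : ℝ) - k' = n * m := by exact_mod_cast hm
      linarith
    · by_cases h2 : c k = c (k' + 1)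
      · have h3 : c (k + 1) ≠ c k' := by
          intro h3
          rw [hc] at h2 h3
          have := Int.le_of_dvd (by norm_num) (show (n : ℤ) ∣ 2 from by
            have := dvd_sub h3 h2
            ring_nf at this
            exact this)
          omega
        have h4 : c (k + 1) ≠ c (k' + 1) := by
          rw [Ne, hc, add_sub_add_right_eq_sub, ← hc]
          exact h1
        rw [if_neg h1, if_pos h2] at e0
        rw [if_neg h3, if_neg h4] at e1
        obtain ⟨m, hm⟩ := (hc _ _).mp h2
        refine ⟨m, ?_⟩
        have hm' : (k : ℝ) - (k' + 1) = n * m := by exact_mod_cast hm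
        linarith
      · rw [if_neg h1, if_neg h2] at e0
        have h4 : c (k + 1) ≠ c (k' + 1) := by
          rw [Ne, hc, add_sub_add_right_eq_sub, ← hc]
          exact h1
        by_cases h3 : c (k + 1) = c k'
        · rw [if_pos h3, if_neg h4] at e1
          obtain ⟨m, hm⟩ := (hc _ _).mp h3
          refine ⟨m, ?_⟩
          have hm' : (k : ℝ) + 1 - k' = n * m := by exact_mod_cast hm
          linarith
        · rw [if_neg h3, if_neg h4] at e1
          linarith
  · rintro ⟨rfl, rfl | ⟨m, hm⟩⟩
    · simp [conePoint]
    · have hd : ((k - k' - m * n : ℤ) : ℝ) = f' - f := by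
        push_cast
        linarith
      have hd1 : (k - k' - m * n : ℤ) ≤ 1 := by
        have : ((k - k' - m * n : ℤ) : ℝ) ≤ (1 : ℤ) := by
          rw [hd]; push_cast; linarith [hf.1, hf'.2]
        exact_mod_cast this
      have hd2 : -1 ≤ (k - k' - m * n : ℤ) := by
        have : ((-1 : ℤ) : ℝ) ≤ ((k - k' - m * n : ℤ) : ℝ) := by
          rw [hd]; push_cast; linarith [hf'.1, hf.2]
        exact_mod_cast this
      obtain h0 | h0 | h0 : (k - k' - m * n : ℤ) = -1 ∨ (k - k' - m * n : ℤ) = 0 ∨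
          (k - k' - m * n : ℤ) = 1 := by omega
      · rw [h0] at hd
        push_cast at hd
        have e1 : f = 1 := by linarith [hf.2, hf'.1]
        have e2 : f' = 0 := by linarith [hf.2, hf'.1]
        have e3 : c (k + 1) = c k' := (hc _ _).mpr ⟨m, by linarith⟩
        simp [conePoint, e1, e2, e3]
      · rw [h0] at hd
        push_cast at hd
        have e1 : f = f' := by linarith
        rw [e1]
        exact conePoint_congr hc r ⟨m, by linarith⟩ f'
      · rw [h0] at hd
        push_cast at hd
        have e1 : f = 0 := by linarith [hf.1, hf'.2]
        have e2 : f' = 1 := by linarith [hf.1, hf'.2]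
        have e3 : c k = c (k' + 1) := (hc _ _).mpr ⟨m, by linarith⟩
        simp [conePoint, e1, e2, e3]

open ZTri.Triangulation in
theorem conePoint_mem_triSet {r f : ℝ} {k : ℤ} (hab : a ≠ c k) (hac : a ≠ c (k + 1))
    (hbc : c k ≠ c (k + 1)) (hr : r ∈ Set.Icc (0 : ℝ) 1) (hf : f ∈ Set.Icc (0 : ℝ) 1) :
    conePoint a c r k f ∈ triSet a (c k) (c (k + 1)) := by
  have h1 : 0 ≤ 1 - r := by linarith [hr.2]
  have h2 : 0 ≤ r * (1 - f) := mul_nonneg hr.1 (by linarith [hf.2])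
  have h3 : 0 ≤ r * f := mul_nonneg hr.1 hf.1
  refine ⟨fun v => ?_, ?_, fun v ha hb hc => ?_⟩
  · simp only [conePoint, Pi.add_apply, Pi.single_apply]
    split_ifs <;> linarith
  · simp only [conePoint, Pi.add_apply, Pi.single_apply, if_true, hab, hac, hbc, hab.symm,
      hac.symm, hbc.symm, if_false]
    ring
  · simp [conePoint, ha, hb, hc]

open ZTri.Triangulation in
theorem exists_conePoint_eq {k : ℤ} (hab : a ≠ c k) (hac : a ≠ c (k + 1))
    (hbc : c k ≠ c (k + 1)) {x : V → ℝ} (hx : x ∈ triSet a (c k) (c (k + 1))) :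
    ∃ r ∈ Set.Icc (0 : ℝ) 1, ∃ f ∈ Set.Icc (0 : ℝ) 1, x = conePoint a c r k f := by
  obtain ⟨h0, h1, h2⟩ := hx
  have ha := h0 a
  have hb := h0 (c k)
  have hc := h0 (c (k + 1))
  -- At the apex the division by zero gives the angle 0, which is harmless because the radius is 0.
  refine ⟨1 - x a, ⟨by linarith, by linarith⟩, x (c (k + 1)) / (1 - x a),
    ⟨div_nonneg hc (by linarith), div_le_one_of_le₀ (by linarith) (by linarith)⟩, ?_⟩
  have h3 : (1 - x a) * (x (c (k + 1)) / (1 - x a)) = x (c (k + 1)) := by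
    by_cases h : 1 - x a = 0
    · rw [h, zero_mul]
      linarith
    · rw [mul_div_cancel₀ _ h]
  have h4 : (1 - x a) * (1 - x (c (k + 1)) / (1 - x a)) = x (c k) := by
    rw [mul_sub, h3]
    linarith
  rw [conePoint, h3, h4, sub_sub_cancel]
  funext v
  simp only [Pi.add_apply, Pi.single_apply]
  by_cases hva : v = a
  · subst hva; simp [hab, hac]
  by_cases hvb : v = c k
  · subst hvb; simp [hab.symm, hbc]
  by_cases hvc : v = c (k + 1)
  · subst hvc; simp [hac.symm, hbc.symm]
  simp [hva, hvb, hvc, h2 v hva hvb hvc]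

end Cone

theorem continuous_of_discrete_middle {A B C Y : Type*} [TopologicalSpace A] [TopologicalSpace B]
    [DiscreteTopology B] [TopologicalSpace C] [TopologicalSpace Y] (g : B → A × C → Y)
    (hg : ∀ b, Continuous (g b)) : Continuous fun x : A × B × C => g x.2.1 (x.1, x.2.2) := by
  have h : Continuous fun y : B × A × C => g y.1 y.2 := continuous_prod_of_discrete_left.mpr hg
  exact h.comp (by fun_prop : Continuous fun x : A × B × C => (x.2.1, x.1, x.2.2))

/-! ### Open and closed stars of vertices -/

namespace ZTri.Triangulation

theorem single_mem_triSet {V : Type*} [DecidableEq V] (a b c : V) (hab : a ≠ b) (hac : a ≠ c) :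
    (Pi.single a 1 : V → ℝ) ∈ triSet a b c := by
  refine ⟨fun v => ?_, by simp [hab.symm, hac.symm], fun v ha _ _ => by simp [ha]⟩
  rw [Pi.single_apply]
  split_ifs <;> norm_num

variable {V : Type*} [Fintype V] [DecidableEq V] {M : Type*} [TopologicalSpace M]
  {T : Triangulation V M}

theorem exists_continuous_coord_eq {X : Type*} [TopologicalSpace X] {p : X → V → ℝ}
    (hp : Continuous p) (hr : ∀ x, p x ∈ realization T.faces) :
    ∃ ψ : X → M, Continuous ψ ∧ ∀ x, T.coord (ψ x) = p x :=
  ⟨fun x => T.homeo ⟨p x, hr x⟩, T.homeo.continuous.comp (hp.subtype_mk hr), fun x => by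
    simp [coord]⟩

/-- The open star of a vertex. -/
def openStar (T : Triangulation V M) (a : V) : Set M := {m | 0 < T.coord m a}

/-- The closed star of a vertex: the union of the faces at the vertex. -/
def closedStar (T : Triangulation V M) (a : V) : Set M :=
  ⋃ F ∈ T.faces.filter (a ∈ ·), {m | ∀ v, v ∉ F → T.coord m v = 0}

theorem isOpen_openStar (a : V) : IsOpen (T.openStar a) :=
  isOpen_lt continuous_const (continuous_coord_apply a)

theorem isClosed_closedStar (a : V) : IsClosed (T.closedStar a) :=
  Set.Finite.isClosed_biUnion (Finset.finite_toSet _) fun F _ => isClosed_support T F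

theorem mem_closedStar {a : V} {m : M} :
    m ∈ T.closedStar a ↔ ∃ b c, T.Tri a b c ∧ T.coord m ∈ triSet a b c := by
  simp only [closedStar, Set.mem_iUnion, Finset.mem_filter]
  constructor
  · rintro ⟨F, ⟨hF, ha⟩, hm⟩
    obtain ⟨b, hb, hba⟩ := Finset.exists_mem_ne
      (by rw [(T.isNClique_face F hF).card_eq]; norm_num) a
    obtain ⟨c, rfl, hc⟩ := exists_eq_insert hF ha hb hba.symm
    have hm' := hc.coord_mem_triSet hm
    refine ⟨b, c, hc.rotate, hc.rotate.coord_mem_triSet fun v hv => hm v ?_⟩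
    simp only [Finset.mem_insert, Finset.mem_singleton] at hv ⊢
    tauto
  · rintro ⟨b, c, ht, hm⟩
    refine ⟨_, ⟨ht, by simp⟩, fun v hv => ?_⟩
    simp only [Finset.mem_insert, Finset.mem_singleton, not_or] at hv
    exact hm.2.2 v hv.1 hv.2.1 hv.2.2

theorem openStar_subset_closedStar (a : V) : T.openStar a ⊆ T.closedStar a := by
  intro m hm
  obtain ⟨-, F, hF, hs⟩ := T.coord_mem m
  refine Set.mem_biUnion (Finset.mem_filter.mpr ⟨hF, ?_⟩) hs
  by_contra ha
  exact (ne_of_gt hm) (hs a ha)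

/-- The star is a union of convex pieces, one in each face at `a`, all of which contain the vertex
`a`. -/
theorem isPreconnected_openStar (a : V) : IsPreconnected (T.openStar a) := by
  have : T.openStar a = ⋃₀ {S | ∃ b c, T.Tri a b c ∧
      S = T.coord ⁻¹' (triSet a b c ∩ {x | 0 < x a})} := by
    ext m
    constructor
    · intro hm
      obtain ⟨b, c, ht, h⟩ := mem_closedStar.mp (openStar_subset_closedStar a hm)
      exact ⟨_, ⟨b, c, ht, rfl⟩, h, hm⟩
    · rintro ⟨-, ⟨b, c, ht, rfl⟩, h⟩
      exact h.2
  rw [this]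
  refine isPreconnected_sUnion (T.point a) _ ?_ ?_
  · rintro - ⟨b, c, ht, rfl⟩
    rw [Set.mem_preimage, coord_point]
    exact ⟨single_mem_triSet a b c ht.ne.1 ht.ne.2.1, by simp⟩
  · rintro - ⟨b, c, ht, rfl⟩
    refine isPreconnected_preimage_coord (Set.inter_subset_left.trans ht.triSet_subset) ?_
    refine ((convex_triSet a b c).inter ?_).isPreconnected
    exact convex_halfSpace_gt (LinearMap.proj (R := ℝ) (φ := fun _ : V => ℝ) a).isLinear 0

/-- A point of a face at `a` is approached along the straight segment from `a`, on which the
coordinate at `a` stays positive. -/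
theorem closure_openStar (a : V) : closure (T.openStar a) = T.closedStar a := by
  refine subset_antisymm
    (closure_minimal (openStar_subset_closedStar a) (isClosed_closedStar a)) fun m hm => ?_
  obtain ⟨b, c, ht, h⟩ := mem_closedStar.mp hm
  obtain ⟨ψ, hψ, hc⟩ := exists_continuous_coord_eq (T := T) (X := unitInterval)
    (p := fun s => (s : ℝ) • Pi.single a 1 + (1 - s : ℝ) • T.coord m) (by fun_prop) fun s =>
      ht.triSet_subset (convex_triSet a b c (single_mem_triSet a b c ht.ne.1 ht.ne.2.1) h
        s.2.1 (by linarith [s.2.2]) (by ring))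
  have h0 : ψ 0 = m := T.isEmbedding_coord.injective (by simp [hc])
  rw [← h0]
  refine map_mem_closure hψ (s := Set.Ioi 0) ?_ fun s hs => ?_
  · rw [closure_Ioi' ⟨1, by simp⟩]
    simp
  · have hs' : 0 < (s : ℝ) := hs
    have h1 : 0 ≤ (1 - s : ℝ) * T.coord m a := mul_nonneg (by linarith [s.2.2]) (T.coord_nonneg m a)
    simp only [openStar, Set.mem_ofPred_eq, hc, Pi.add_apply, Pi.smul_apply, Pi.single_eq_same,
      smul_eq_mul, mul_one]
    linarith

/-- An edge is drawn along a simple curve. -/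
theorem exists_isEmbedding_segment [T2Space M] {u v : V} (huv : T.graph.Adj u v) :
    ∃ γ : unitInterval → M, Topology.IsEmbedding γ ∧ γ 0 = T.point u ∧ γ 1 = T.point v ∧
      Set.range γ = T.segment u v := by
  obtain ⟨w, hw⟩ := exists_tri_of_adj huv
  have hne := huv.ne
  obtain ⟨ψ, hψ, hc⟩ := exists_continuous_coord_eq (T := T) (X := unitInterval)
    (p := fun s => (1 - s : ℝ) • Pi.single u 1 + (s : ℝ) • Pi.single v 1) (by fun_prop) fun s =>
      hw.rotate.triSet_subset (convex_triSet u v w (single_mem_triSet u v w hne hw.ne.1.symm)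
        (by
          have := single_mem_triSet v u w hne.symm hw.ne.2.1.symm
          refine ⟨this.1, by simp [hne, hw.ne.2.1], fun z _ hz _ => by simp [hz]⟩)
        (by linarith [s.2.2]) s.2.1 (by ring))
  refine ⟨ψ, (hψ.isClosedEmbedding fun s t hst => ?_).isEmbedding,
    T.isEmbedding_coord.injective (by simp [hc, coord_point]),
    T.isEmbedding_coord.injective (by simp [hc, coord_point]), ?_⟩
  · have h1 := congrFun (congrArg T.coord hst) v
    simp only [hc, Pi.add_apply, Pi.smul_apply, Pi.single_eq_same, smul_eq_mul, mul_one,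
      Pi.single_eq_of_ne hne.symm, mul_zero, zero_add] at h1
    exact Subtype.ext h1
  · ext m
    rw [mem_segment]
    constructor
    · rintro ⟨s, rfl⟩ z hzu hzv
      simp [hc, hzu, hzv]
    · intro hm
      have h1 := (T.coord_mem m).1.2
      rw [hw.rotate.sum_eq fun z hu hv _ => hm z hu hv, hm w hw.ne.1 hw.ne.2.1] at h1
      have hu := T.coord_nonneg m u
      have hv := T.coord_nonneg m v
      refine ⟨⟨T.coord m v, hv, by linarith⟩, T.isEmbedding_coord.injective ?_⟩
      rw [hc]
      funext z
      simp only [Pi.add_apply, Pi.smul_apply, Pi.single_apply, smul_eq_mul]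
      by_cases hzu : z = u
      · subst hzu
        simp [hne]
        linarith
      by_cases hzv : z = v
      · subst hzv
        simp [hne.symm]
      simp [hzu, hzv, hm z hzu hzv]

theorem eq_point_of_support {w : V} {m : M} (h : ∀ v, v ≠ w → T.coord m v = 0) :
    m = T.point w := by
  refine T.isEmbedding_coord.injective ?_
  rw [coord_point]
  funext v
  by_cases hv : v = w
  · subst hv
    have h1 := (T.coord_mem m).1.2
    rw [Finset.sum_eq_single v (fun z _ hz => h z hz) (by simp)] at h1
    simp [h1]
  · simp [hv, h v hv]

end ZTri.Triangulation

/-! ### The components of the complement of Γ_II -/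

namespace ZTri.ZOrientation

open Triangulation

variable {V : Type*} [Fintype V] [DecidableEq V] {M : Type*} [TopologicalSpace M]
  {T : Triangulation V M} {τ : ZOrientation T}

theorem gammaII_isEmbedded [T2Space M] : τ.gammaII.IsEmbedded := by
  refine ⟨?_, fun u v h => exists_isEmbedding_segment h.1.1, ?_, ?_⟩
  · intro u v huv
    have h := congrFun (congrArg T.coord (show T.point u = T.point v from huv)) u
    rw [coord_point, coord_point] at h
    by_contra hne
    rw [Pi.single_eq_same, Pi.single_eq_of_ne fun h' => hne (Subtype.ext h')] at h
    exact one_ne_zero h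
  · intro u v w h hw
    have hw' := mem_segment.mp (show T.point w ∈ T.segment u v from hw) w
    rw [coord_point, Pi.single_eq_same] at hw'
    by_contra! hcon
    exact one_ne_zero (hw' (fun h => hcon.1 (Subtype.ext h)) fun h => hcon.2 (Subtype.ext h))
  · rintro u v u' v' h h' hne m ⟨hm, hm'⟩
    replace hm := mem_segment.mp (show m ∈ T.segment u v from hm)
    replace hm' := mem_segment.mp (show m ∈ T.segment u' v' from hm')
    -- If both coordinates were nonzero, the two arcs would have the same ends, which simplicity
    -- excludes.
    have hzero : T.coord m u = 0 ∨ T.coord m v = 0 := by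
      by_contra! hcon
      have hu : u = u' ∨ u = v' := by
        by_contra! hc
        exact hcon.1 (hm' u (fun e => hc.1 (Subtype.ext e)) fun e => hc.2 (Subtype.ext e))
      have hv : v = u' ∨ v = v' := by
        by_contra! hc
        exact hcon.2 (hm' v (fun e => hc.1 (Subtype.ext e)) fun e => hc.2 (Subtype.ext e))
      have huv : u ≠ v := fun e => gammaII_isSimple.1 v (e ▸ h)
      rcases hu with rfl | rfl <;> rcases hv with rfl | rfl
      · exact huv rfl
      · exact hne rfl
      · exact gammaII_isSimple.2 _ _ h h'
      · exact huv rfl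
    rcases hzero with hz | hz
    · refine ⟨v, (eq_point_of_support fun w hw => ?_).symm⟩
      by_cases hwu : w = u
      · exact hwu ▸ hz
      · exact hm w hwu hw
    · refine ⟨u, (eq_point_of_support fun w hw => ?_).symm⟩
      by_cases hwv : w = v
      · exact hwv ▸ hz
      · exact hm w hw hwv

variable (hτ : ∀ F ∈ T.faces, τ.IsTypeIFace F)

include hτ

theorem IsSeparated.mem_compl_carrier_iff (hs : τ.IsSeparated) {m : M} :
    m ∈ τ.gammaII.carrierᶜ ↔ ∃ a, ¬ τ.IsTypeIIVertex a ∧ m ∈ T.openStar a := by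
  rw [Set.mem_compl_iff, mem_carrier_iff hτ]
  constructor
  · intro h
    obtain ⟨-, F, hF, hm⟩ := T.coord_mem m
    obtain ⟨a, b, c, rfl, hd⟩ := exists_dirFace hτ hF
    refine ⟨a, hs _ _ _ hd, lt_of_le_of_ne (T.coord_nonneg m a) fun h0 => h ?_⟩
    refine ⟨b, c, hd.isTypeII, mem_segment.mpr fun w hb hc => ?_⟩
    by_cases hwa : w = a
    · rw [hwa, ← h0]
    · exact hm w (by simp [hwa, hb, hc])
  · rintro ⟨a, ha, hm⟩ ⟨u, v, huv, hm'⟩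
    refine (ne_of_gt hm) (mem_segment.mp hm' a ?_ ?_)
    · rintro rfl
      exact ha ⟨_, huv, by simp⟩
    · rintro rfl
      exact ha ⟨_, huv, by simp⟩

/-- A common point would put both vertices into one face, but a face has only one vertex off Γ_II.
-/
theorem IsSeparated.disjoint_openStar (hs : τ.IsSeparated) {a b : V} (ha : ¬ τ.IsTypeIIVertex a)
    (hb : ¬ τ.IsTypeIIVertex b) (hab : a ≠ b) : Disjoint (T.openStar a) (T.openStar b) := by
  rw [Set.disjoint_left]
  intro m hma hmb
  obtain ⟨-, F, hF, hm⟩ := T.coord_mem m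
  have haF : a ∈ F := by
    by_contra h
    exact (ne_of_gt hma) (hm a h)
  have hbF : b ∈ F := by
    by_contra h
    exact (ne_of_gt hmb) (hm b h)
  obtain ⟨w, -, hw⟩ := exists_eq_insert hF haF hbF hab
  have := hs.cases hτ hw
  tauto

/-- The components of the complement of `Γ_II` are open stars. -/
theorem IsSeparated.exists_eq_openStar (hs : τ.IsSeparated) {F : Set M}
    (hF : τ.gammaII.IsFace F) : ∃ a, ¬ τ.IsTypeIIVertex a ∧ F = T.openStar a := by
  obtain ⟨p, hp, rfl⟩ := hF
  obtain ⟨a, ha, hpa⟩ := (hs.mem_compl_carrier_iff hτ).mp hp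
  refine ⟨a, ha, subset_antisymm ?_ ?_⟩
  · refine isPreconnected_connectedComponentIn.subset_left_of_subset_union (isOpen_openStar a)
      (v := ⋃ b ∈ {b | ¬ τ.IsTypeIIVertex b ∧ a ≠ b}, T.openStar b)
      (isOpen_biUnion fun b _ => isOpen_openStar b) ?_ ?_ ⟨p, mem_connectedComponentIn hp, hpa⟩
    · rw [Set.disjoint_iUnion₂_right]
      exact fun b hb => hs.disjoint_openStar hτ ha hb.1 hb.2
    · intro m hm
      obtain ⟨b, hb, hmb⟩ := (hs.mem_compl_carrier_iff hτ).mp (connectedComponentIn_subset _ _ hm)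
      by_cases hab : a = b
      · exact Or.inl (hab ▸ hmb)
      · exact Or.inr (Set.mem_biUnion (show b ∈ {b | _ ∧ _} from ⟨hb, hab⟩) hmb)
  · exact (isPreconnected_openStar a).subset_connectedComponentIn hpa fun m hm =>
      (hs.mem_compl_carrier_iff hτ).mpr ⟨a, ha, hm⟩

theorem exists_mem_triSet_of_mem_closedStar {a : V} (ha : ¬ τ.IsTypeIIVertex a)
    {c : ℤ → V} (hcover : ∀ b d, τ.DirFace a b d → ∃ k, b = c k ∧ d = c (k + 1)) {m : M}
    (hm : m ∈ T.closedStar a) : ∃ k, T.coord m ∈ triSet a (c k) (c (k + 1)) := by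
  obtain ⟨b, d, ht, hm⟩ := mem_closedStar.mp hm
  rcases dirFace_of_not_isTypeIIVertex hτ ht ha with h | h
  · obtain ⟨k, rfl, rfl⟩ := hcover _ _ h
    exact ⟨k, hm⟩
  · obtain ⟨k, rfl, rfl⟩ := hcover _ _ h
    refine ⟨k, hm.1, by rw [add_right_comm]; exact hm.2.1, fun v h1 h2 h3 => hm.2.2 v h1 h3 h2⟩

/-- The parameter space of radius, sector and position in the sector is compact. It maps onto the
disk and onto the closed star with the same fibres, so the two quotients are homeomorphic. The
radius is one minus the coordinate at `a`, whence the interiors correspond. -/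
theorem IsSeparated.exists_homeomorph_closedStar [T2Space M] (hs : τ.IsSeparated) {a : V}
    (ha : ¬ τ.IsTypeIIVertex a) :
    ∃ φ : Metric.closedBall (0 : EuclideanSpace ℝ (Fin 2)) 1 ≃ₜ T.closedStar a,
      ∀ x, (φ x : M) ∈ T.openStar a ↔ (x : EuclideanSpace ℝ (Fin 2)) ∈ Metric.ball 0 1 := by
  obtain ⟨n, c, hn, hc, hdir, hcover⟩ := hs.exists_cycle hτ ha
  have hn0 : n ≠ 0 := by omega
  have hac : ∀ k, a ≠ c k := fun k => (hdir k).tri.ne.1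
  let X := unitInterval × Fin n × unitInterval
  let L := Complex.orthonormalBasisOneI.repr
  have hnorm : ∀ x : X, ‖L ((x.1 : ℂ) * circlePoint n ((x.2.1 : ℕ) + x.2.2))‖ = x.1 := by
    intro x
    rw [LinearIsometryEquiv.norm_map, norm_mul, norm_circlePoint, mul_one]
    simp [abs_of_nonneg x.1.2.1]
  let q : X → Metric.closedBall (0 : EuclideanSpace ℝ (Fin 2)) 1 := fun x =>
    ⟨L ((x.1 : ℂ) * circlePoint n ((x.2.1 : ℕ) + x.2.2)), by
      rw [mem_closedBall_zero_iff, hnorm]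
      exact x.1.2.2⟩
  have hqc : Continuous q := by
    refine Continuous.subtype_mk (continuous_of_discrete_middle (A := unitInterval) (B := Fin n)
      (C := unitInterval) (fun k y => L ((y.1 : ℂ) *
      circlePoint n ((k : ℕ) + y.2))) fun k => ?_) _
    refine L.continuous.comp ?_
    unfold circlePoint
    fun_prop
  have hqs : Function.Surjective q := by
    rintro ⟨y, hy⟩
    obtain ⟨k, f, hz⟩ := exists_circlePoint hn0 (L.symm y)
    rw [mem_closedBall_zero_iff] at hy
    rw [LinearIsometryEquiv.norm_map] at hz
    refine ⟨(⟨‖y‖, norm_nonneg _, hy⟩, k, f), Subtype.ext ?_⟩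
    change L ((‖y‖ : ℂ) * circlePoint n ((k : ℕ) + f)) = y
    rw [← hz, LinearIsometryEquiv.apply_symm_apply]
  have hmem : ∀ x : X, conePoint a c x.1 (x.2.1 : ℕ) x.2.2 ∈
      triSet a (c (x.2.1 : ℕ)) (c ((x.2.1 : ℕ) + 1)) := fun x =>
    conePoint_mem_triSet (hac _) (hac _) (hdir _).tri.ne.2.2 x.1.2 x.2.2.2
  obtain ⟨ψ, hψ, hψc⟩ := exists_continuous_coord_eq (T := T) (X := X)
    (p := fun x => conePoint a c x.1 (x.2.1 : ℕ) x.2.2)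
    (continuous_of_discrete_middle (A := unitInterval) (B := Fin n)
      (C := unitInterval) (fun k y => conePoint a c y.1 (k : ℕ) y.2) fun k => by
      unfold conePoint
      refine continuous_pi fun v => ?_
      simp only [Pi.add_apply, Pi.single_apply]
      refine Continuous.add (Continuous.add ?_ ?_) ?_ <;> split_ifs <;> fun_prop)
    fun x => (hdir _).tri.triSet_subset (hmem x)
  let p : X → T.closedStar a := fun x =>
    ⟨ψ x, mem_closedStar.mpr ⟨_, _, (hdir _).tri, (hψc x).symm ▸ hmem x⟩⟩
  have hps : Function.Surjective p := by
    rintro ⟨m, hm⟩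
    obtain ⟨k, hk⟩ := exists_mem_triSet_of_mem_closedStar hτ ha hcover hm
    obtain ⟨r, hr, f, hf, he⟩ := exists_conePoint_eq (hac _) (hac _) (hdir k).tri.ne.2.2 hk
    have hpos : (0 : ℤ) < n := by omega
    have h0 := Int.emod_nonneg k hpos.ne'
    have h1 := Int.emod_lt_of_pos k hpos
    refine ⟨(⟨r, hr⟩, ⟨(k % n).toNat, by omega⟩, ⟨f, hf⟩), Subtype.ext
      (T.isEmbedding_coord.injective ?_)⟩
    change T.coord (ψ _) = T.coord m
    rw [hψc, he]
    refine conePoint_congr hc r ?_ f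
    simp only [Int.toNat_of_nonneg h0]
    exact ⟨-(k / n), by linarith [Int.emod_add_mul_ediv k n]⟩
  have hfib : ∀ x y, q x = q y ↔ p x = p y := by
    intro x y
    have h1 : p x = p y ↔ conePoint a c x.1 (x.2.1 : ℕ) x.2.2 =
        conePoint a c y.1 (y.2.1 : ℕ) y.2.2 := by
      rw [← hψc x, ← hψc y, T.isEmbedding_coord.injective.eq_iff]
      exact Subtype.ext_iff
    rw [h1, conePoint_eq_iff hn hc hac x.2.2.2 y.2.2.2]
    have h2 := circlePoint_eq_iff hn0 (s := (x.2.1 : ℕ) + x.2.2) (t := (y.2.1 : ℕ) + y.2.2)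
    simp only [Int.cast_natCast]
    rw [← h2]
    constructor
    · intro h
      have h3 : L ((x.1 : ℂ) * circlePoint n ((x.2.1 : ℕ) + x.2.2)) =
        L ((y.1 : ℂ) * circlePoint n ((y.2.1 : ℕ) + y.2.2)) := congrArg Subtype.val h
      have h4 : (x.1 : ℝ) = y.1 := by rw [← hnorm x, ← hnorm y, h3]
      refine ⟨h4, or_iff_not_imp_left.mpr fun h5 => ?_⟩
      have h6 := L.injective h3
      rw [← h4] at h6
      exact mul_left_cancel₀ (by exact_mod_cast h5) h6
    · rintro ⟨h3, h4⟩
      refine Subtype.ext (congrArg L ?_)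
      rw [← h3]
      rcases h4 with h4 | h4
      · rw [h4]
        simp
      · rw [h4]
  obtain ⟨φ, hφ⟩ := exists_homeomorph_of_fibers_eq hqc hqs (hψ.subtype_mk _) hps hfib
  refine ⟨φ, fun y => ?_⟩
  obtain ⟨x, rfl⟩ := hqs y
  rw [hφ, mem_ball_zero_iff]
  change 0 < T.coord (ψ x) a ↔ ‖L ((x.1 : ℂ) * circlePoint n ((x.2.1 : ℕ) + x.2.2))‖ < 1
  rw [hψc, conePoint_apply_apex hac, hnorm, sub_pos]

/-- The frontier consists of the points of the closed star with coordinate zero at `a`, which is the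
base of the cone. -/
theorem IsSeparated.isBoundedByDirectedCycle_openStar (hs : τ.IsSeparated) {a : V}
    (ha : ¬ τ.IsTypeIIVertex a) : τ.gammaII.IsBoundedByDirectedCycle (T.openStar a) := by
  obtain ⟨n, c, hn, hc, hdir, hcover⟩ := hs.exists_cycle hτ ha
  obtain ⟨n, rfl⟩ : ∃ k, n = k + 1 := ⟨n - 1, by omega⟩
  -- The successor in `Fin (n + 1)` wraps around from the last index to 0, as `c` does by
  -- periodicity.
  have hsucc : ∀ i : Fin (n + 1), c ((i + 1 : Fin (n + 1)) : ℕ) = c ((i : ℕ) + 1) := by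
    intro i
    rw [hc]
    by_cases h : i = Fin.last n
    · subst h
      rw [Fin.last_add_one]
      exact ⟨-1, by simp⟩
    · rw [Fin.val_add_one_of_lt (Fin.lt_last_iff_ne_last.mpr h)]
      simp
  have hfr : frontier (T.openStar a) = T.closedStar a \ T.openStar a := by
    rw [frontier, closure_openStar, (isOpen_openStar a).interior_eq]
  refine ⟨n, fun i => ⟨c (i : ℕ), (hdir _).isTypeIIVertex_left⟩, ?_, ?_, ?_⟩
  · intro i j hij
    have h := (hc _ _).mp (congrArg Subtype.val hij)
    have h0 : (i : ℤ) - (j : ℤ) = 0 := Int.eq_zero_of_abs_lt_dvd h (by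
      rw [abs_lt]
      push_cast
      constructor <;> omega)
    exact Fin.ext (by omega)
  · intro i
    have := hdir (i : ℕ)
    rw [← hsucc] at this
    exact ⟨this.isTypeII, this.passes⟩
  · rw [hfr]
    ext m
    simp only [Set.mem_iUnion]
    have hcurve : ∀ i : Fin (n + 1), m ∈ τ.gammaII.curve
        ⟨c (i : ℕ), (hdir _).isTypeIIVertex_left⟩
        ⟨c ((i + 1 : Fin (n + 1)) : ℕ), (hdir _).isTypeIIVertex_left⟩ ↔
          m ∈ T.segment (c (i : ℕ)) (c ((i : ℕ) + 1)) := fun i => by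
      change m ∈ T.segment (c (i : ℕ)) (c ((i + 1 : Fin (n + 1)) : ℕ)) ↔ _
      rw [hsucc]
    simp only [hcurve]
    constructor
    · rintro ⟨hm, hm'⟩
      obtain ⟨k, hk⟩ := exists_mem_triSet_of_mem_closedStar hτ ha hcover hm
      have h0 : T.coord m a = 0 := le_antisymm (not_lt.mp hm') (T.coord_nonneg m a)
      have hpos : (0 : ℤ) < (n + 1 : ℕ) := by omega
      have h1 := Int.emod_nonneg k hpos.ne'
      have h2 := Int.emod_lt_of_pos k hpos
      have hdvd : ((n + 1 : ℕ) : ℤ) ∣ k % (n + 1 : ℕ) - k :=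
        ⟨-(k / (n + 1 : ℕ)), by linarith [Int.emod_add_mul_ediv k (n + 1 : ℕ)]⟩
      refine ⟨⟨(k % (n + 1 : ℕ)).toNat, by omega⟩, mem_segment.mpr fun w hw hw' => ?_⟩
      simp only [Int.toNat_of_nonneg h1] at hw hw'
      rw [(hc _ _).mpr hdvd] at hw
      rw [(hc _ (k + 1)).mpr (by rwa [add_sub_add_right_eq_sub])] at hw'
      by_cases hwa : w = a
      · rw [hwa, h0]
      · exact hk.2.2 w hwa hw hw'
    · rintro ⟨i, hi⟩
      rw [mem_segment] at hi
      have hd := hdir (i : ℕ)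
      have h0 := hi a hd.tri.ne.1 hd.tri.ne.2.1
      refine ⟨mem_closedStar.mpr ⟨_, _, hd.tri, hd.tri.coord_mem_triSet fun v hv => ?_⟩, ?_⟩
      · simp only [Finset.mem_insert, Finset.mem_singleton, not_or] at hv
        exact hi v hv.2.1 hv.2.2
      · exact not_lt.mpr h0.le

end ZTri.ZOrientation

/-! ### From closed to open disks, and the equivalence -/

namespace ZTri.DrawnDigraph

/-- The faces of a closed 2-cell embedding are open disks. -/
theorem IsClosedTwoCellEmbedding.nonempty_homeomorph_ball {W M : Type*} [TopologicalSpace M]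
    {D : DrawnDigraph W M} (h : D.IsClosedTwoCellEmbedding) {F : Set M} (hF : D.IsFace F) :
    Nonempty (F ≃ₜ Metric.ball (0 : EuclideanSpace ℝ (Fin 2)) 1) := by
  obtain ⟨φ, hφ⟩ := h.2 F hF
  let g : Metric.ball (0 : EuclideanSpace ℝ (Fin 2)) 1 → M := fun x =>
    φ ⟨x, Metric.ball_subset_closedBall x.2⟩
  have hg : Topology.IsEmbedding g :=
    Topology.IsEmbedding.subtypeVal.comp
      (φ.isEmbedding.comp (Topology.IsEmbedding.inclusion Metric.ball_subset_closedBall))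
  have hr : Set.range g = F := by
    ext m
    constructor
    · rintro ⟨x, rfl⟩
      exact (hφ _).mpr x.2
    · intro hm
      obtain ⟨x, hx⟩ := φ.surjective ⟨m, subset_closure hm⟩
      have hx' : (φ x : M) = m := congrArg Subtype.val hx
      exact ⟨⟨x, (hφ x).mp (hx' ▸ hm)⟩, hx'⟩
  exact ⟨(hg.toHomeomorph.trans (Homeomorph.setCongr hr)).symm⟩

end ZTri.DrawnDigraph

theorem theorem1 {M : Type*} [TopologicalSpace M] [T2Space M] [CompactSpace M] [ConnectedSpace M]
    [ChartedSpace (EuclideanSpace ℝ (Fin 2)) M] {V : Type*} [Fintype V] [DecidableEq V]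
    (T : ZTri.Triangulation V M) (τ : ZTri.ZOrientation T)
    (hτ : ∀ F ∈ T.faces, τ.IsTypeIFace F) :
    List.TFAE [
      ∀ Z, T.IsZigzag Z → τ.IsHomogeneous Z,
      τ.gammaII.IsSimple ∧ τ.gammaII.IsEulerian ∧ τ.gammaII.IsClosedTwoCellEmbedding ∧
        ∀ F, τ.gammaII.IsFace F → τ.gammaII.IsBoundedByDirectedCycle F,
      ∀ F, τ.gammaII.IsFace F →
        Nonempty (F ≃ₜ Metric.ball (0 : EuclideanSpace ℝ (Fin 2)) 1)] := by
  tfae_have 1 → 2 := by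
    intro h
    have hs := ZTri.ZOrientation.isSeparated_of_isHomogeneous hτ h
    refine ⟨ZTri.ZOrientation.gammaII_isSimple, hs.gammaII_isEulerian hτ,
      ⟨ZTri.ZOrientation.gammaII_isEmbedded, fun F hF => ?_⟩, fun F hF => ?_⟩
    · obtain ⟨a, ha, rfl⟩ := hs.exists_eq_openStar hτ hF
      rw [ZTri.Triangulation.closure_openStar]
      exact hs.exists_homeomorph_closedStar hτ ha
    · obtain ⟨a, ha, rfl⟩ := hs.exists_eq_openStar hτ hF
      exact hs.isBoundedByDirectedCycle_openStar hτ ha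
  tfae_have 2 → 3 := fun h F hF => h.2.2.1.nonempty_homeomorph_ball hF
  tfae_have 3 → 1 := fun h Z hZ =>
    (ZTri.ZOrientation.isSeparated_of_homeomorph_ball hτ h).isHomogeneous hτ hZ
  tfae_finish
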